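/- A \emph{bidirected graph} $B$ consists of a finite loopless multigraph with vertex set $V(B)$ and edge set $E(B)$ (parallel edges are allowed), together with a sign $\sigma(e,u)\in\{+,-\}$ for every edge $e$ and every endpoint $u$ of $e$. An \emph{oriented edge} $\vec e$ is an edge $e$ together with a choice of one of its endpoints as tail and the other as head. A \emph{trail} is a sequence $v_0\vec e_1v_1\dots\vec e_\ell v_\ell$ in which $\vec e_i$ has tail $v_{i-1}$ and head $v_i$, the edges $e_1,\dots,e_\ell$ are pairwise distinct, and $\sigma(e_{i+1},v_i)=-\sigma(e_i,v_i)$ for $1\le i\le \ell-1$. A \emph{path} is a trail whose vertices $v_0,\dots,v_\ell$ are pairwise distinct. An $r$--$(v,\alpha)$ path is a path from $r$ to $v$ whose last edge has sign $\alpha$ at $v$. For $v\neq r$ and $\alpha\in\{+,-\}$ let $\lambda_B^{\alpha,\mathrm{path}}(r,v)$ be the maximum number of pairwise edge-disjoint $r$--$(v,\alpha)$ paths in $B$. Let $B$ be rooted at a vertex $r$. An edge $e$ is \emph{trail-directable} if there is exactly one orientation $\vec e$ of $e$ for which $B$ contains a trail that starts in $r$, has no internal vertex equal to $r$, and has $\vec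 e$ as its last oriented edge. $B$ is \emph{edge-clean} if every edge incident with $r$ is trail-directable. $B$ is a \emph{flame} if $$|E(B)|\le \sum_{v\in V(B)\setminus\{r\}}\ \sum_{\alpha\in\{+,-\}}\lambda_B^{\alpha,\mathrm{path}}(r,v).$$ \textbf{Theorem.} Every edge-clean bidirected graph $B$ rooted at $r$ has a spanning subgraph $F$ (with the same vertex set and root, and the inherited signs) such that $F$ is a flame and $$\lambda_F^{\alpha,\mathrm{path}}(r,v)=\lambda_B^{\alpha,\mathrm{path}}(r,v)\qquad\text{for every } v\in V(B)\setminus\{r\}\text{ and every }\alpha\in\{+,-\}.$$ -/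

import Mathlib

/-- A bidirected graph with vertex set `V` and edge set `E`: a loopless multigraph (parallel edges
are allowed) in which every half-edge `(e, u)`, where `u` is an endpoint of `e`, has a sign in
`ℤˣ = {1, -1}`. -/
structure BidirectedGraph (V : Type*) (E : Type*) where
  ends : E → Sym2 V
  loopless : ∀ e, ¬ (ends e).IsDiag
  sign : {h : E × V // h.2 ∈ ends h.1} → ℤˣ

namespace BidirectedGraph

/-- An oriented edge: an edge together with an ordering of its two endpoints. -/
@[ext]
structure OrientedEdge {V E : Type*} (B : BidirectedGraph V E) where
  edge : E
  tail : V
  head : V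
  ends_eq : B.ends edge = s(tail, head)

/-- The sign of the underlying edge at the tail. -/
def OrientedEdge.tailSign {V E : Type*} {B : BidirectedGraph V E} (d : B.OrientedEdge) : ℤˣ :=
  B.sign ⟨(d.edge, d.tail), by simp [d.ends_eq]⟩

/-- The sign of the underlying edge at the head. -/
def OrientedEdge.headSign {V E : Type*} {B : BidirectedGraph V E} (d : B.OrientedEdge) : ℤˣ :=
  B.sign ⟨(d.edge, d.head), by simp [d.ends_eq]⟩

/-- The list `p` of oriented edges leads from `x` to `y`: the first one has tail `x`, the head of
each is the tail of the next, and the last one has head `y` (and `x = y` if `p` is empty). -/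
def Joins {V E : Type*} (B : BidirectedGraph V E) : V → List B.OrientedEdge → V → Prop
  | x, [], y => x = y
  | x, d :: p, y => d.tail = x ∧ B.Joins d.head p y

/-- `p` is the sequence of oriented edges of an `x`--`y` trail: no edge is repeated (in either
orientation), and at every internal position the two consecutive edges have opposite signs. -/
structure IsTrail {V E : Type*} (B : BidirectedGraph V E) (x : V) (p : List B.OrientedEdge)
    (y : V) : Prop where
  joins : B.Joins x p y
  edges_nodup : (p.map OrientedEdge.edge).Nodup
  signs : p.IsChain (fun d d' => d'.tailSign = -d.headSign)

/-- `p` is the sequence of oriented edges of an `x`--`y` path: a trail whose vertex sequence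
`x, d₁.head, d₂.head, …` has no repetition. -/
structure IsPath {V E : Type*} (B : BidirectedGraph V E) (x : V) (p : List B.OrientedEdge)
    (y : V) : Prop extends B.IsTrail x p y where
  vertices_nodup : (x :: p.map OrientedEdge.head).Nodup

/-- `p` is an `x`--`(y, α)` path: an `x`--`y` path that arrives at `y` with sign `α`. -/
def IsSignedPath {V E : Type*} (B : BidirectedGraph V E) (x : V) (p : List B.OrientedEdge)
    (y : V) (α : ℤˣ) : Prop :=
  B.IsPath x p y ∧ ∃ d, p.getLast? = some d ∧ d.headSign = α

/-- `p` is an `r`--`d` trail for the oriented edge `d`: a trail that starts in `r`, has no internal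
vertex equal to `r`, and whose terminal oriented edge is `d`. -/
def IsRootTrailTo {V E : Type*} (B : BidirectedGraph V E) (r : V) (p : List B.OrientedEdge)
    (d : B.OrientedEdge) : Prop :=
  B.IsTrail r p d.head ∧ p.getLast? = some d ∧ r ∉ (p.map OrientedEdge.head).dropLast

/-- The edge `e` is trail-directable with respect to the root `r`: exactly one of its
orientations `d` is the terminal oriented edge of some `r`--`d` trail. -/
def TrailDirectable {V E : Type*} (B : BidirectedGraph V E) (r : V) (e : E) : Prop :=
  ∃! d : B.OrientedEdge, d.edge = e ∧ ∃ p, B.IsRootTrailTo r p d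

/-- `B` with root `r` is edge-clean: all edges incident with `r` are trail-directable. -/
def EdgeClean {V E : Type*} (B : BidirectedGraph V E) (r : V) : Prop :=
  ∀ e, r ∈ B.ends e → B.TrailDirectable r e

/-- `P` is a set of pairwise edge-disjoint `x`--`(y, α)` paths. -/
def IsEdgeDisjointPaths {V E : Type*} (B : BidirectedGraph V E) (x y : V) (α : ℤˣ)
    (P : Finset (List B.OrientedEdge)) : Prop :=
  (∀ p ∈ P, B.IsSignedPath x p y α) ∧
  (P : Set (List B.OrientedEdge)).Pairwise
    (fun p q => List.Disjoint (p.map OrientedEdge.edge) (q.map OrientedEdge.edge))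

/-- The signed local edge-connectivity `λ^{α, path}(x, y)`: the maximum number of edge-disjoint
`x`--`(y, α)` paths. For a finite edge set the maximum is attained, see
`isGreatest_pathConnectivity`. -/
noncomputable def pathConnectivity {V E : Type*} (B : BidirectedGraph V E) (x y : V)
    (α : ℤˣ) : ℕ :=
  sSup {n | ∃ P, B.IsEdgeDisjointPaths x y α P ∧ P.card = n}

theorem isGreatest_pathConnectivity {V E : Type*} [Finite E] (B : BidirectedGraph V E) (x y : V)
    (α : ℤˣ) :
    IsGreatest {n | ∃ P, B.IsEdgeDisjointPaths x y α P ∧ P.card = n}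
      (B.pathConnectivity x y α) := by
  classical
  have hne : Set.Nonempty {n | ∃ P, B.IsEdgeDisjointPaths x y α P ∧ P.card = n} :=
    ⟨0, ∅, ⟨by simp, by simp⟩, rfl⟩
  have hb : BddAbove {n | ∃ P, B.IsEdgeDisjointPaths x y α P ∧ P.card = n} := by
    refine ⟨Nat.card E, ?_⟩
    rintro n ⟨P, ⟨hP, hd⟩, rfl⟩
    have hl : ∀ p : P, ∃ e : E, e ∈ p.1.map OrientedEdge.edge := by
      rintro ⟨p, hp⟩
      obtain ⟨-, d, hd', -⟩ := hP p hp
      exact ⟨d.edge, List.mem_map_of_mem (List.mem_of_getLast? hd')⟩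
    choose f hf using hl
    have hinj : Function.Injective f := by
      intro p q hpq
      by_contra hne
      exact hd p.2 q.2 (fun h => hne (Subtype.ext h)) (hf p) (hpq ▸ hf q)
    simpa using Nat.card_le_card_of_injective f hinj
  exact ⟨Nat.sSup_mem hne hb, fun n hn => le_csSup hb hn⟩

/-- `B` with root `r` is a flame: its number of edges is at most the sum of
`λ^{α, path}(r, v)` over all vertices `v ≠ r` and both signs `α`. -/
def IsFlame {V E : Type*} [Fintype V] [DecidableEq V] [Finite E] (B : BidirectedGraph V E)
    (r : V) : Prop :=
  Nat.card E ≤ ∑ v ∈ Finset.univ.erase r, ∑ α : ℤˣ, B.pathConnectivity r v α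

/-- The spanning subgraph of `B` with edge set `F` and the signs inherited from `B`. -/
def spanningSubgraph {V E : Type*} (B : BidirectedGraph V E) (F : Set E) :
    BidirectedGraph V F where
  ends e := B.ends e
  loopless e := B.loopless e
  sign h := B.sign ⟨(h.1.1, h.1.2), h.2⟩

end BidirectedGraph

/-! A walk of a bidirected graph runs through states, that is, vertices together with the sign of
arrival; every oriented edge leads from one state to another. Suppose first that no vertex other
than `r` is reachable by paths with both signs. Then the oriented edges that leave reachable states
form an ordinary digraph, apart from those that end in `r`. It contains at most one orientation of
each edge (`injOn_edge_rootArcs`), and its paths from `r` are the bidirected ones. In this case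
Lovász's flame theorem (`Digraph.exists_flame`) suffices.

In general, a vertex reachable with both signs produces a blossom, as in Edmonds' matching
algorithm: a closed walk from a reachable base state `(u, α)` to `(u, -α)`, around which every other
vertex is reached with both signs (`exists_cycle`, `isBlossomPartition_cycle`). Contracting blossoms
repeatedly leads to the directed case (`exists_isBlossomStructure`). Contracted paths lift
(`exists_lift`), and paths from `r` project, because they can enter a nontrivial blossom only in its
base state (`exists_proj`).

Edge-cleanness says that there is no closed trail at `r`, and this is used twice. The root never
lies in a nontrivial blossom; and no two edge-disjoint contracted paths end in the base of a
nontrivial blossom, since their lifts would close up to a trail through that blossom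
(`not_disjoint_of_base`). By Menger's theorem such a base has connectivity at most one, so in the
Lovász flame at most one arc enters it. Hence at most one of several arc-disjoint paths uses a given
blossom, and the lifts stay edge-disjoint.

The required edge set consists of the edges of the Lovász flame and of at most two further edges for
each vertex absorbed by a blossom. The former are paid for by the connectivities of their heads, the
latter by the absorbed vertex itself, which is reached with both signs. -/

/-! ### Walks along abstract arcs. -/

/-- The list `p` of arcs leads from `x` to `y`, where the arc `d` has tail `t d` and head `h d`. -/
def Walk {A S : Type*} (t h : A → S) : S → List A → S → Prop
  | x, [], y => x = y
  | x, d :: p, y => t d = x ∧ Walk t h (h d) p y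

namespace Walk

variable {A S T : Type*} {t h : A → S}

@[simp] theorem nil_iff {x y : S} : Walk t h x [] y ↔ x = y := Iff.rfl

@[simp] theorem cons_iff {x y : S} {d : A} {p : List A} :
    Walk t h x (d :: p) y ↔ t d = x ∧ Walk t h (h d) p y := Iff.rfl

theorem append_iff {x y : S} {p q : List A} :
    Walk t h x (p ++ q) y ↔ ∃ z, Walk t h x p z ∧ Walk t h z q y := by
  induction p generalizing x with
  | nil => simp
  | cons d p ih => simp [ih, and_assoc]

theorem append {x y z : S} {p q : List A} (hp : Walk t h x p y) (hq : Walk t h y q z) :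
    Walk t h x (p ++ q) z := append_iff.2 ⟨y, hp, hq⟩

theorem concat_iff {x y : S} {d : A} {p : List A} :
    Walk t h x (p ++ [d]) y ↔ Walk t h x p (t d) ∧ h d = y := by
  simp [append_iff]

theorem map {f : S → T} {x y : S} {p : List A} (hp : Walk t h x p y) :
    Walk (f ∘ t) (f ∘ h) (f x) p (f y) := by
  induction p generalizing x with
  | nil => simp_all
  | cons d p ih => exact ⟨congrArg f hp.1, ih hp.2⟩

theorem end_mem {x y : S} {p : List A} (hp : Walk t h x p y) (hne : p ≠ []) :
    y ∈ p.map h := by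
  induction p generalizing x with
  | nil => simp at hne
  | cons d p ih =>
    rcases eq_or_ne p [] with rfl | h'
    · simp_all
    · exact List.mem_cons_of_mem _ (ih hp.2 h')

theorem end_mem_cons {x y : S} {p : List A} (hp : Walk t h x p y) : y ∈ x :: p.map h := by
  rcases eq_or_ne p [] with rfl | h'
  · simp_all
  · exact List.mem_cons_of_mem _ (hp.end_mem h')

theorem tail_mem {x y : S} {p : List A} (hp : Walk t h x p y) {d : A} (hd : d ∈ p) :
    t d ∈ x :: p.map h := by
  obtain ⟨p₁, p₂, rfl⟩ := List.append_of_mem hd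
  obtain ⟨z, h₁, h₂⟩ := append_iff.1 hp
  rw [h₂.1]
  have := h₁.end_mem_cons
  simp only [List.map_append, List.mem_cons, List.mem_append] at this ⊢
  tauto

theorem exists_split {f : S → T} {x y : S} {p : List A} (hp : Walk t h x p y) {v : T}
    (hv : v ∈ f x :: p.map (fun d => f (h d))) :
    ∃ p₁ p₂ z, p = p₁ ++ p₂ ∧ Walk t h x p₁ z ∧ Walk t h z p₂ y ∧ f z = v := by
  induction p generalizing x with
  | nil => exact ⟨[], [], x, by simp_all⟩
  | cons d p ih =>
    rcases List.mem_cons.1 hv with hv | hv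
    · exact ⟨[], d :: p, x, rfl, rfl, hp, hv.symm⟩
    · obtain ⟨p₁, p₂, z, rfl, h₁, h₂, h₃⟩ := ih hp.2 hv
      exact ⟨d :: p₁, p₂, z, rfl, ⟨hp.1, h₁⟩, h₂, h₃⟩

theorem congr_arcs {t' h' : A → S} {x y : S} {p : List A} (hp : Walk t h x p y)
    (ht : ∀ d ∈ p, t' d = t d) (hh : ∀ d ∈ p, h' d = h d) : Walk t' h' x p y := by
  induction p generalizing x with
  | nil => exact hp
  | cons d p ih =>
    refine ⟨(ht d (by simp)).trans hp.1, ?_⟩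
    rw [hh d (by simp)]
    exact ih hp.2 (fun e he => ht e (by simp [he])) (fun e he => hh e (by simp [he]))

end Walk

/-! ### Signed vertices as states of a walk. -/

/-- The opposite of a signed vertex. -/
def mate {V : Type*} (x : V × ℤˣ) : V × ℤˣ := (x.1, -x.2)

@[simp] theorem mate_fst {V : Type*} (x : V × ℤˣ) : (mate x).1 = x.1 := rfl

@[simp] theorem mate_mk {V : Type*} (v : V) (ε : ℤˣ) : mate (v, ε) = (v, -ε) := rfl

@[simp] theorem mate_mate {V : Type*} (x : V × ℤˣ) : mate (mate x) = x := by simp [mate]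

theorem Int.units_neg_ne (ε : ℤˣ) : -ε ≠ ε := by
  rcases Int.units_eq_one_or ε with rfl | rfl <;> decide

theorem Int.units_eq_or_eq_neg (ε δ : ℤˣ) : δ = ε ∨ δ = -ε := by
  rcases Int.units_eq_one_or ε with rfl | rfl <;> rcases Int.units_eq_one_or δ with rfl | rfl <;>
    decide

theorem mate_ne {V : Type*} (x : V × ℤˣ) : mate x ≠ x :=
  fun h => Int.units_neg_ne _ (congrArg Prod.snd h)

theorem eq_or_eq_mate {V : Type*} {x y : V × ℤˣ} (h : y.1 = x.1) : y = x ∨ y = mate x := by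
  rcases Int.units_eq_or_eq_neg x.2 y.2 with h' | h'
  · exact Or.inl (Prod.ext h h')
  · exact Or.inr (Prod.ext h h')

/-! ### Bidirected walks and paths in terms of darts. -/

/-- A system of darts: every edge has two orientations, which are exchanged by `rev`. -/
structure DartSystem (A E : Type*) where
  rev : A → A
  edge : A → E
  rev_rev : ∀ d, rev (rev d) = d
  edge_rev : ∀ d, edge (rev d) = edge d
  eq_or_eq_rev : ∀ {d e}, edge d = edge e → d = e ∨ d = rev e

namespace DartSystem

attribute [simp] rev_rev edge_rev

variable {A E V : Type*} (D : DartSystem A E) (h : A → V × ℤˣ)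

/-- The state in which a walk has to be in order to continue with the dart `d`, where `h d` is the
state in which `d` arrives. -/
def tail (d : A) : V × ℤˣ := mate (h (D.rev d))

@[simp] theorem tail_rev (d : A) : D.tail h (D.rev d) = mate (h d) := by simp [tail]

theorem head_rev (d : A) : h (D.rev d) = mate (D.tail h d) := by simp [tail]

/-- A walk of the bidirected graph given by the heads `h` of the darts. -/
abbrev BiWalk : V × ℤˣ → List A → V × ℤˣ → Prop := Walk (D.tail h) h

/-- The vertices at which the darts of `p` arrive. -/
def verts (h : A → V × ℤˣ) (p : List A) : List V := p.map (fun d => (h d).1)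

@[simp] theorem verts_nil : verts h [] = [] := rfl

@[simp] theorem verts_cons (d : A) (p : List A) : verts h (d :: p) = (h d).1 :: verts h p := rfl

@[simp] theorem verts_append (p q : List A) : verts h (p ++ q) = verts h p ++ verts h q := by
  simp [verts]

/-- A walk without repeated vertices. -/
structure BiPath (x : V × ℤˣ) (p : List A) (y : V × ℤˣ) : Prop where
  walk : D.BiWalk h x p y
  nodup : (x.1 :: verts h p).Nodup

/-- The state `y` is the end of a path that starts in the vertex `r`. -/
def Reach (r : V) (y : V × ℤˣ) : Prop := ∃ γ p, D.BiPath h (r, γ) p y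

/-- The reversal of a list of darts. -/
def reverse (p : List A) : List A := (p.map D.rev).reverse

variable {D h}

/-- A vertex is left with the sign opposite to that of arrival, so a walk read backwards passes
through the opposite states. -/
theorem BiWalk.reverse {x y : V × ℤˣ} {p : List A} (hp : D.BiWalk h x p y) :
    D.BiWalk h (mate y) (D.reverse p) (mate x) := by
  induction p generalizing x with
  | nil => simp_all [DartSystem.reverse]
  | cons d p ih =>
    have := ih hp.2
    simp only [DartSystem.reverse, List.map_cons, List.reverse_cons] at this ⊢
    rw [BiWalk, Walk.concat_iff]
    refine ⟨by simpa using this, ?_⟩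
    rw [D.head_rev h, hp.1]

theorem BiWalk.verts_reverse {x y : V × ℤˣ} {p : List A} (hp : D.BiWalk h x p y) :
    y.1 :: verts h (D.reverse p) = (x.1 :: verts h p).reverse := by
  induction p generalizing x with
  | nil => simp_all [DartSystem.reverse]
  | cons d p ih =>
    have := ih hp.2
    have e : D.reverse (d :: p) = D.reverse p ++ [D.rev d] := by simp [DartSystem.reverse]
    rw [e, verts_append, ← List.cons_append, this]
    simp [verts, D.head_rev h, hp.1]

theorem BiWalk.end_mem {x y : V × ℤˣ} {p : List A} (hp : D.BiWalk h x p y) (hne : p ≠ []) :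
    y.1 ∈ verts h p := by
  obtain ⟨d, hd, h'⟩ := List.mem_map.1 (Walk.end_mem hp hne)
  exact List.mem_map.2 ⟨d, hd, by rw [h']⟩

theorem BiWalk.end_mem_cons {x y : V × ℤˣ} {p : List A} (hp : D.BiWalk h x p y) :
    y.1 ∈ x.1 :: verts h p := by
  rcases eq_or_ne p [] with rfl | h'
  · simp_all
  · exact List.mem_cons_of_mem _ (hp.end_mem h')

theorem BiWalk.tail_mem {x y : V × ℤˣ} {p : List A} (hp : D.BiWalk h x p y) {d : A}
    (hd : d ∈ p) : (D.tail h d).1 ∈ x.1 :: verts h p := by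
  rcases List.mem_cons.1 (Walk.tail_mem hp hd) with h' | h'
  · simp [h']
  · obtain ⟨e, he, h'⟩ := List.mem_map.1 h'
    exact List.mem_cons_of_mem _ (List.mem_map.2 ⟨e, he, by rw [h']⟩)

theorem head_mem_verts {p : List A} {d : A} (hd : d ∈ p) : (h d).1 ∈ verts h p :=
  List.mem_map.2 ⟨d, hd, rfl⟩

theorem BiWalk.exists_split {x y : V × ℤˣ} {p : List A} (hp : D.BiWalk h x p y) {v : V}
    (hv : v ∈ x.1 :: verts h p) :
    ∃ p₁ p₂ ε, p = p₁ ++ p₂ ∧ D.BiWalk h x p₁ (v, ε) ∧ D.BiWalk h (v, ε) p₂ y := by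
  obtain ⟨p₁, p₂, z, h₁, h₂, h₃, rfl⟩ := Walk.exists_split (f := Prod.fst) hp hv
  exact ⟨p₁, p₂, z.2, h₁, h₂, h₃⟩

theorem BiPath.reverse {x y : V × ℤˣ} {p : List A} (hp : D.BiPath h x p y) :
    D.BiPath h (mate y) (D.reverse p) (mate x) :=
  ⟨hp.walk.reverse, by
    rw [mate_fst, hp.walk.verts_reverse, List.nodup_reverse]; exact hp.nodup⟩

theorem mem_reverse {p : List A} {d : A} : d ∈ D.reverse p ↔ D.rev d ∈ p := by
  simp only [DartSystem.reverse, List.mem_reverse, List.mem_map]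
  constructor
  · rintro ⟨e, he, rfl⟩; simpa using he
  · exact fun h' => ⟨_, h', by simp⟩

theorem reverse_edges (p : List A) :
    (D.reverse p).map D.edge = (p.map D.edge).reverse := by
  simp [DartSystem.reverse, Function.comp_def]

theorem BiPath.of_append_left {x y : V × ℤˣ} {p q : List A} (hp : D.BiPath h x (p ++ q) y)
    {z : V × ℤˣ} (hw : D.BiWalk h x p z) : D.BiPath h x p z :=
  ⟨hw, by
    have := hp.nodup
    rw [verts_append, ← List.cons_append] at this
    exact this.of_append_left⟩

theorem BiPath.concat {x : V × ℤˣ} {p : List A} {d : A} (hp : D.BiPath h x p (D.tail h d))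
    (hd : (h d).1 ∉ x.1 :: verts h p) : D.BiPath h x (p ++ [d]) (h d) := by
  refine ⟨Walk.concat_iff.2 ⟨hp.walk, rfl⟩, ?_⟩
  rw [verts_append, ← List.cons_append, List.nodup_append']
  refine ⟨hp.nodup, by simp, ?_⟩
  simpa [List.disjoint_right] using hd

/-- A walk whose arrival vertices are distinct has no repeated edges. -/
theorem BiWalk.edges_nodup {x y : V × ℤˣ} {p : List A} (hp : D.BiWalk h x p y)
    (hn : (verts h p).Nodup) : (p.map D.edge).Nodup := by
  induction p using List.reverseRecOn generalizing y with
  | nil => simp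
  | append_singleton p d ih =>
    rw [BiWalk, Walk.concat_iff] at hp
    rw [verts_append] at hn
    rw [List.map_append, List.nodup_append']
    refine ⟨ih hp.1 hn.of_append_left, by simp, ?_⟩
    rw [List.disjoint_right]
    simp only [List.map_cons, List.map_nil, List.mem_singleton, List.mem_map, not_exists, not_and,
      forall_eq]
    intro e he hed
    -- The same dart would repeat its head. The reversed dart, if it came immediately before `d`,
    -- would violate the sign rule; otherwise the walk returns to the tail of `d`, which repeats the
    -- head of `D.rev d`.
    rcases D.eq_or_eq_rev hed with rfl | rfl
    · exact (List.disjoint_right.1 (List.nodup_append'.1 hn).2.2 (by simp)) (head_mem_verts he)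
    · obtain ⟨p₁, p₂, rfl⟩ := List.append_of_mem he
      obtain ⟨z, h₁, -, h₂⟩ := Walk.append_iff.1 hp.1
      rcases eq_or_ne p₂ [] with rfl | hne
      · have : h (D.rev d) = D.tail h d := h₂
        rw [D.head_rev h] at this
        exact mate_ne _ this
      · have h₃ : (D.tail h d).1 ∈ verts h p₂ := BiWalk.end_mem h₂ hne
        have h₄ := hn.of_append_left
        rw [verts_append, verts_cons, D.head_rev h] at h₄
        exact (List.nodup_cons.1 h₄.of_append_right).1 (by simpa using h₃)

/-- If no vertex other than the root can be reached with both signs, then every dart that leaves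
a reachable state arrives at a reachable state. -/
theorem BiPath.reach_head {r : V} {γ : ℤˣ} {p : List A} {d : A}
    (hu : ∀ v ε, v ≠ r → D.Reach h r (v, ε) → ¬ D.Reach h r (v, -ε))
    (hp : D.BiPath h (r, γ) p (D.tail h d)) (hd : (h d).1 ≠ (D.tail h d).1) :
    D.Reach h r (h d) := by
  by_cases hm : (h d).1 ∈ r :: verts h p
  · obtain ⟨p₁, p₂, ε, rfl, h₁, h₂⟩ := hp.walk.exists_split hm
    have hp₁ := hp.of_append_left h₁
    rcases eq_or_eq_mate (x := ((h d).1, ε)) (y := h d) rfl with h' | h'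
    · rw [h']; exact ⟨γ, p₁, hp₁⟩
    -- The path passes through the head of `d` with the other sign, so its initial segment can
    -- continue along `D.rev d`. This reaches the tail of `d` with the sign opposite to that of `p`.
    · exfalso
      have hne : p₂ ≠ [] := by
        rintro rfl
        have h₃ : ((h d).1, ε) = D.tail h d := h₂
        exact hd (by rw [← h₃])
      have hT := BiWalk.end_mem h₂ hne
      have hn := hp.nodup
      rw [verts_append, ← List.cons_append, List.nodup_append'] at hn
      have hT' := List.disjoint_right.1 hn.2.2 hT
      refine hu (D.tail h d).1 (D.tail h d).2 (fun h' => hT' (by simp [h'])) ⟨γ, _, hp⟩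
        ⟨γ, p₁ ++ [D.rev d], ?_⟩
      have : D.BiPath h (r, γ) (p₁ ++ [D.rev d]) (h (D.rev d)) := by
        apply BiPath.concat
        · rw [tail_rev, h']; simpa using hp₁
        · rw [D.head_rev h]; exact hT'
      rw [D.head_rev h] at this
      exact this
  · exact ⟨γ, _, hp.concat hm⟩

end DartSystem

/-! ### Contraction of blossoms and lifting of paths. -/

namespace DartSystem

variable {A E V : Type*} {D : DartSystem A E} {h : A → V × ℤˣ}

/-- The contraction of states: each vertex `v` is contracted to `b v`, and the states at `v ≠ b v`
become the state at `b v` whose sign is opposite to the base sign `s (b v)`. -/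
noncomputable def contract (b : V → V) (s : V → ℤˣ) (x : V × ℤˣ) : V × ℤˣ :=
  open Classical in if b x.1 = x.1 then x else (b x.1, -s (b x.1))

theorem contract_of_eq {b : V → V} {s : V → ℤˣ} {x : V × ℤˣ} (hx : b x.1 = x.1) :
    contract b s x = x := if_pos hx

theorem contract_of_ne {b : V → V} {s : V → ℤˣ} {x : V × ℤˣ} (hx : b x.1 ≠ x.1) :
    contract b s x = (b x.1, -s (b x.1)) := if_neg hx

@[simp] theorem contract_fst {b : V → V} {s : V → ℤˣ} (x : V × ℤˣ) :
    (contract b s x).1 = b x.1 := by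
  unfold contract; split_ifs with hx
  · exact hx.symm
  · rfl

theorem tail_contract (b : V → V) (s : V → ℤˣ) (d : A) :
    D.tail (contract b s ∘ h) d = mate (contract b s (mate (D.tail h d))) := by
  simp [tail]

theorem mate_contract_of_eq {b : V → V} {s : V → ℤˣ} {x : V × ℤˣ} (hx : b x.1 = x.1) :
    mate (contract b s (mate x)) = x := by
  rw [contract_of_eq (by simpa using hx), mate_mate]

theorem mate_contract_of_ne {b : V → V} {s : V → ℤˣ} {x : V × ℤˣ} (hx : b x.1 ≠ x.1) :
    mate (contract b s (mate x)) = (b x.1, s (b x.1)) := by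
  rw [contract_of_ne (by simpa using hx)]; simp

variable (D h)

/-- The fibres of `b` are blossoms: from the base state `(b v, s (b v))` of a nontrivial fibre,
every state of the fibre can be reached inside the fibre by a path with edges in the set `F`, and
the base itself can be reached again with the opposite sign. -/
structure IsBlossomPartition (b : V → V) (s : V → ℤˣ) (F : Set E) : Prop where
  idem : ∀ v, b (b v) = b v
  reach : ∀ v, b v ≠ v → ∀ β, ∃ p, D.BiPath h (b v, s (b v)) p (v, β) ∧
    ∀ d ∈ p, b (h d).1 = b v ∧ D.edge d ∈ F
  loop : ∀ v, b v ≠ v → ∃ p, D.BiWalk h (b v, s (b v)) p (b v, -s (b v)) ∧ (verts h p).Nodup ∧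
    ∀ d ∈ p, b (h d).1 = b v
  ncard_le : F.ncard ≤ 2 * {v | b v ≠ v}.ncard

variable {D h}

namespace IsBlossomPartition

variable {b : V → V} {s : V → ℤˣ} {F : Set E}

/-- Two states that are identified by the contraction are joined inside their fibre. -/
theorem exists_connection (hb : IsBlossomPartition D h b s F) {x y : V × ℤˣ}
    (hxy : contract b s x = mate (contract b s (mate y))) :
    ∃ p, D.BiPath h x p y ∧ (∀ d ∈ p, b (h d).1 = b x.1 ∧ D.edge d ∈ F) ∧
      (p ≠ [] → ∃ v, b v = b x.1 ∧ b v ≠ v) := by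
  have hfst : b x.1 = b y.1 := by simpa using congrArg Prod.fst hxy
  -- Here `x` is contracted as an arrival and `y` as a departure. If `b` moves both, they get
  -- opposite signs at the base. If it moves only one, a path from the base serves, reversed when
  -- `x` is the one moved.
  by_cases hx : b x.1 = x.1
  · by_cases hy : b y.1 = y.1
    · rw [contract_of_eq hx, mate_contract_of_eq hy] at hxy
      subst hxy
      exact ⟨[], ⟨rfl, by simp⟩, by simp, by simp⟩
    · rw [contract_of_eq hx, mate_contract_of_ne hy] at hxy
      obtain ⟨p, hp, hp'⟩ := hb.reach y.1 hy y.2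
      subst hxy
      refine ⟨p, hp, ?_, fun _ => ⟨y.1, hfst.symm, hy⟩⟩
      intro d hd
      rw [hfst]
      exact hp' d hd
  · by_cases hy : b y.1 = y.1
    · rw [contract_of_ne hx, mate_contract_of_eq hy] at hxy
      obtain ⟨p, hp, hp'⟩ := hb.reach x.1 hx (-x.2)
      have hr := hp.reverse
      rw [mate_mk, mate_mk, neg_neg, hxy] at hr
      refine ⟨_, hr, ?_, fun _ => ⟨x.1, rfl, hx⟩⟩
      intro d hd
      have hd' := hp' _ (mem_reverse.1 hd)
      refine ⟨?_, by simpa using hd'.2⟩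
      have := hp.walk.tail_mem (mem_reverse.1 hd)
      rw [tail_rev, mate_fst] at this
      rcases List.mem_cons.1 this with h₁ | h₁
      · rw [h₁]; exact hb.idem _
      · obtain ⟨e, he, h₂⟩ := List.mem_map.1 h₁
        rw [← h₂]; exact (hp' e he).1
    · rw [contract_of_ne hx, mate_contract_of_ne hy, hfst] at hxy
      exact absurd (congrArg Prod.snd hxy) (Int.units_neg_ne _)

/-- Paths of the contracted graph lift to paths of the original graph. -/
theorem exists_lift (hb : IsBlossomPartition D h b s F) {p : List A} {x y : V × ℤˣ}
    (hp : D.BiPath (contract b s ∘ h) (contract b s x) p (mate (contract b s (mate y)))) :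
    ∃ q, D.BiPath h x q y ∧ ∀ d ∈ q, b (h d).1 ∈ b x.1 :: verts (contract b s ∘ h) p ∧
      (d ∈ p ∨ D.edge d ∈ F ∧ b (D.tail h d).1 = b (h d).1 ∧ ∃ v, b v = b (h d).1 ∧ b v ≠ v) := by
  -- A connection inside a fibre is inserted before each dart and at the end. A contracted path
  -- meets each fibre once, so no vertex is repeated.
  induction p generalizing x with
  | nil =>
    obtain ⟨q, hq, hq₁, hq₂⟩ := hb.exists_connection (show contract b s x = _ from hp.walk)
    refine ⟨q, hq, fun d hd => ⟨by simp [(hq₁ d hd).1], Or.inr ⟨(hq₁ d hd).2, ?_, ?_⟩⟩⟩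
    · rw [(hq₁ d hd).1]
      rcases List.mem_cons.1 (hq.walk.tail_mem hd) with h₁ | h₁
      · rw [h₁]
      · obtain ⟨e, he, h₂⟩ := List.mem_map.1 h₁
        rw [← h₂]; exact (hq₁ e he).1
    · rw [(hq₁ d hd).1]; exact hq₂ (List.ne_nil_of_mem hd)
  | cons d p ih =>
    have hn := hp.nodup
    rw [verts_cons, List.nodup_cons] at hn
    obtain ⟨q₂, hq₂, hq₂'⟩ := ih (x := h d) ⟨hp.walk.2, hn.2⟩
    have ht : D.tail (contract b s ∘ h) d = contract b s x := hp.walk.1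
    rw [tail_contract] at ht
    obtain ⟨q, hq, hq₁, hq'⟩ := hb.exists_connection ht.symm
    have hqm : ∀ v ∈ x.1 :: verts h q, b v = b x.1 := by
      intro v hv
      rcases List.mem_cons.1 hv with h₁ | h₁
      · rw [h₁]
      · obtain ⟨e, he, h₂⟩ := List.mem_map.1 h₁
        rw [← h₂]; exact (hq₁ e he).1
    have hqm₂ : ∀ v ∈ (h d).1 :: verts h q₂, b v ∈ b (h d).1 :: verts (contract b s ∘ h) p := by
      intro v hv
      rcases List.mem_cons.1 hv with h₁ | h₁
      · simp [h₁]
      · obtain ⟨e, he, h₂⟩ := List.mem_map.1 h₁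
        rw [← h₂]; exact (hq₂' e he).1
    refine ⟨q ++ d :: q₂, ⟨Walk.append hq.walk ⟨rfl, hq₂.walk⟩, ?_⟩, ?_⟩
    · rw [verts_append, verts_cons, ← List.cons_append, List.nodup_append']
      refine ⟨hq.nodup, hq₂.nodup, ?_⟩
      intro v hv hv'
      have h₂ := hqm₂ v hv'
      rw [hqm v hv] at h₂
      exact hn.1 (by simpa using h₂)
    · intro e he
      rcases List.mem_append.1 he with he | he
      · refine ⟨by simp [(hq₁ e he).1], Or.inr ⟨(hq₁ e he).2, ?_, ?_⟩⟩
        · rw [(hq₁ e he).1]; exact hqm _ (hq.walk.tail_mem he)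
        · rw [(hq₁ e he).1]; exact hq' (List.ne_nil_of_mem he)
      · rcases List.mem_cons.1 he with rfl | he
        · exact ⟨by simp, Or.inl (by simp)⟩
        · refine ⟨List.mem_cons_of_mem _ (by simpa using (hq₂' e he).1), ?_⟩
          rcases (hq₂' e he).2 with h₁ | h₁
          · exact Or.inl (by simp [h₁])
          · exact Or.inr h₁

end IsBlossomPartition

/-- A path whose vertices are not moved by `b` is a path of the contracted graph. -/
theorem BiPath.contract {b : V → V} {s : V → ℤˣ} {x y : V × ℤˣ} {p : List A}
    (hp : D.BiPath h x p y) (hf : ∀ v ∈ x.1 :: verts h p, b v = v) :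
    D.BiPath (contract b s ∘ h) x p y := by
  have hh : ∀ d ∈ p, (DartSystem.contract b s ∘ h) d = h d := fun d hd =>
    contract_of_eq (hf _ (List.mem_cons_of_mem _ (head_mem_verts hd)))
  refine ⟨Walk.congr_arcs hp.walk (fun d hd => ?_) hh, ?_⟩
  · rw [tail_contract, mate_contract_of_eq (hf _ (hp.walk.tail_mem hd))]
  · have : verts (DartSystem.contract b s ∘ h) p = verts h p :=
      List.map_congr_left fun d hd => by rw [hh d hd]
    rw [this]; exact hp.nodup

/-- If some vertex can be reached with both signs, then there is a reachable state `(u, α)` and a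
closed walk from `(u, α)` to `(u, -α)` without further repeated vertices. -/
theorem exists_cycle {r : V}
    (hc : ∀ γ γ' p, p ≠ [] → (verts h p).Nodup → ¬ D.BiWalk h (r, γ) p (r, γ'))
    {v : V} {ε γ γ' : ℤˣ} {p q : List A} (hv : v ≠ r) (hp : D.BiPath h (r, γ) p (v, ε))
    (hq : D.BiPath h (r, γ') q (v, -ε)) :
    ∃ u α p c, u ≠ r ∧ D.BiPath h (r, γ) p (u, α) ∧ D.BiWalk h (u, α) c (u, -α) ∧
      (verts h c).Nodup ∧ (∀ w ∈ verts h c, w ∈ r :: verts h p → w = u) ∧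
      ∃ w ∈ verts h c, w ≠ u := by
  classical
  induction hk : p.length using Nat.strong_induction_on generalizing v ε p q with
  | _ k ih =>
  -- The shortest nonempty final segment of `q` that starts on `p` is taken; by minimality it meets
  -- `p` again only in `v`.
  have hex : ∃ n, ∃ q₁ q₂ x ξ, q = q₁ ++ q₂ ∧ q₂.length = n ∧ q₂ ≠ [] ∧
      D.BiWalk h (r, γ') q₁ (x, ξ) ∧ D.BiWalk h (x, ξ) q₂ (v, -ε) ∧ x ∈ r :: verts h p := by
    refine ⟨_, [], q, r, γ', rfl, rfl, ?_, rfl, hq.walk, by simp⟩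
    rintro rfl
    exact hv (congrArg Prod.fst (show (r, γ') = (v, -ε) from hq.walk)).symm
  obtain ⟨q₁, q₂, x, ξ, rfl, hlen, hne, h₁, h₂, hx⟩ := Nat.find_spec hex
  have hmin := fun m hm => Nat.find_min hex (m := m) hm
  rw [← hlen] at hmin
  have hdis : ∀ w ∈ verts h q₂, w ∈ r :: verts h p → w = v := by
    intro w hw hw'
    by_contra hwv
    obtain ⟨d, hd, rfl⟩ := List.mem_map.1 hw
    obtain ⟨a, c, rfl⟩ := List.append_of_mem hd
    rw [← List.singleton_append, ← List.append_assoc] at h₂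
    obtain ⟨z, h₃, h₄⟩ := Walk.append_iff.1 h₂
    have hz := (Walk.concat_iff.1 h₃).2
    subst hz
    have hcne : c ≠ [] := by
      rintro rfl
      exact hwv (congrArg Prod.fst (show h d = (v, -ε) from h₄))
    refine hmin c.length ?_ ⟨q₁ ++ (a ++ [d]), c, (h d).1, (h d).2, by simp, rfl, hcne,
      Walk.append h₁ h₃, h₄, hw'⟩
    simp; omega
  have hvq₂ : v ∈ verts h q₂ := BiWalk.end_mem h₂ hne
  have hnq := hq.nodup
  rw [verts_append, ← List.cons_append, List.nodup_append'] at hnq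
  have hxq : x ∈ r :: verts h q₁ := BiWalk.end_mem_cons h₁
  have hxv : x ≠ v := by
    rintro rfl
    exact hnq.2.2 hxq hvq₂
  obtain ⟨p₁, p₂, ξ', rfl, h₃, h₄⟩ := hp.walk.exists_split hx
  have hp₁ := hp.of_append_left h₃
  have hp₂ne : p₂ ≠ [] := by
    rintro rfl
    exact hxv (congrArg Prod.fst (show (x, ξ') = (v, ε) from h₄))
  have hnp := hp.nodup
  rw [verts_append, ← List.cons_append, List.nodup_append'] at hnp
  have hxp : x ∈ r :: verts h p₁ := BiWalk.end_mem_cons h₃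
  have hrev := h₂.reverse
  have hrv := h₂.verts_reverse
  rw [mate_mk, mate_mk, neg_neg] at hrev
  have hxq₂ : x ∉ verts h q₂ := hnq.2.2 hxq
  -- Following `p` from `x` to `v` and then `q` backwards gives a closed walk at `x`.
  have hcyc := Walk.append h₄ hrev
  have hrevmem : ∀ w, w ∈ verts h (D.reverse q₂) → w = x ∨ (w ∈ verts h q₂ ∧ w ≠ v) := by
    intro w hw
    have hw' : w ∈ v :: verts h (D.reverse q₂) := List.mem_cons_of_mem _ hw
    have hnd : (v :: verts h (D.reverse q₂)).Nodup := by
      rw [hrv, List.nodup_reverse]; exact List.nodup_cons.2 ⟨hxq₂, hnq.2.1⟩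
    rw [hrv, List.mem_reverse, List.mem_cons] at hw'
    rcases hw' with h' | h'
    · exact Or.inl h'
    · exact Or.inr ⟨h', fun h'' => (List.nodup_cons.1 hnd).1 (h'' ▸ hw)⟩
  have hnodup : (verts h (p₂ ++ D.reverse q₂)).Nodup := by
    rw [verts_append, List.nodup_append']
    refine ⟨hnp.2.1, ?_, ?_⟩
    · have hnd : (v :: verts h (D.reverse q₂)).Nodup := by
        rw [hrv, List.nodup_reverse]; exact List.nodup_cons.2 ⟨hxq₂, hnq.2.1⟩
      exact hnd.of_cons
    · intro w hw hw'
      rcases hrevmem w hw' with rfl | ⟨h', h''⟩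
      · exact hnp.2.2 hxp hw
      · exact h'' (hdis w h' (by simp [hw]))
  have hcne : p₂ ++ D.reverse q₂ ≠ [] := by simp [hp₂ne]
  rcases eq_or_ne x r with rfl | hxr
  · have hp₁nil : p₁ = [] := by
      by_contra hp₁nil
      exact (List.nodup_cons.1 hp₁.nodup).1 (h₃.end_mem hp₁nil)
    exact absurd hcyc (hc _ _ _ hcne hnodup)
  -- If `p` and `q` pass `x` with equal signs, the closed walk is the required one. Otherwise `x` is
  -- reached with both signs, and `p₁` is shorter than `p`.
  rcases Int.units_eq_or_eq_neg ξ' ξ with rfl | rfl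
  · refine ⟨x, ξ, p₁, _, hxr, hp₁, hcyc, hnodup, ?_, v, ?_, hxv.symm⟩
    · intro w hw hw'
      rw [verts_append, List.mem_append] at hw
      rcases hw with hw | hw
      · exact absurd hw (hnp.2.2 hw')
      · rcases hrevmem w hw with rfl | ⟨h', h''⟩
        · rfl
        · refine absurd (hdis w h' ?_) h''
          rw [verts_append, ← List.cons_append]
          exact List.mem_append_left _ hw'
    · rw [verts_append]
      exact List.mem_append_left _ (BiWalk.end_mem h₄ hp₂ne)
  · refine ih p₁.length ?_ hxr hp₁ (hq.of_append_left h₁) rfl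
    rw [← hk]
    have := List.length_pos_of_ne_nil hp₂ne
    simp; omega

/-- The vertices of a closed walk at `(u, α)` form a blossom. -/
theorem isBlossomPartition_cycle [Finite V] {u : V} {α : ℤˣ} {c : List A}
    (hc : D.BiWalk h (u, α) c (u, -α)) (hn : (verts h c).Nodup) (hw : ∃ w ∈ verts h c, w ≠ u)
    {b : V → V} (hb : ∀ v ∈ verts h c, b v = u) (hb' : ∀ v ∉ verts h c, b v = v) :
    IsBlossomPartition D h b (fun _ => α) {e | ∃ d ∈ c, D.edge d = e} := by
  classical
  obtain ⟨w, hw, hwu⟩ := hw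
  have hcne : c ≠ [] := by rintro rfl; simp at hw
  have hu : u ∈ verts h c := BiWalk.end_mem hc hcne
  have hmem : ∀ v, b v ≠ v → v ∈ verts h c := fun v hv => by
    by_contra h'; exact hv (hb' v h')
  refine ⟨?_, ?_, ?_, ?_⟩
  · intro v
    by_cases hv : v ∈ verts h c
    · rw [hb v hv, hb u hu]
    · rw [hb' v hv, hb' v hv]
  · intro v hv β
    have hvc := hmem v hv
    rw [hb v hvc] at hv ⊢
    obtain ⟨c₁, c₂, ε, rfl, h₁, h₂⟩ := hc.exists_split (List.mem_cons_of_mem _ hvc)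
    have hc₁ : c₁ ≠ [] := by
      rintro rfl; exact hv (congrArg Prod.fst (show (u, α) = (v, ε) from h₁))
    have hc₂ : c₂ ≠ [] := by
      rintro rfl; exact hv (congrArg Prod.fst (show (v, ε) = (u, -α) from h₂)).symm
    have hv₁ := BiWalk.end_mem h₁ hc₁
    have hu₂ := BiWalk.end_mem h₂ hc₂
    rw [verts_append, List.nodup_append'] at hn
    -- Going round the closed walk in one direction reaches `v` with one sign, going round in the
    -- other direction reaches it with the other.
    rcases Int.units_eq_or_eq_neg ε β with rfl | rfl
    · refine ⟨c₁, ⟨h₁, List.nodup_cons.2 ⟨fun h' => hn.2.2 h' hu₂, hn.1⟩⟩, fun d hd => ?_⟩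
      exact ⟨hb _ (by simp [head_mem_verts hd]), d, by simp [hd], rfl⟩
    · have hp : D.BiPath h (v, ε) c₂ (u, -α) :=
        ⟨h₂, List.nodup_cons.2 ⟨fun h' => hn.2.2 hv₁ h', hn.2.1⟩⟩
      have hr := hp.reverse
      rw [mate_mk, mate_mk, neg_neg] at hr
      refine ⟨_, hr, fun d hd => ?_⟩
      have hd' := mem_reverse.1 hd
      refine ⟨?_, _, by simp [hd'], D.edge_rev d⟩
      have := h₂.tail_mem hd'
      rw [tail_rev, mate_fst] at this
      apply hb
      rw [verts_append, List.mem_append]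
      rcases List.mem_cons.1 this with h' | h'
      · left; rw [h']; exact hv₁
      · exact Or.inr h'
  · intro v hv
    rw [hb v (hmem v hv)]
    exact ⟨c, hc, hn, fun d hd => hb _ (head_mem_verts hd)⟩
  · have h₁ : {e | ∃ d ∈ c, D.edge d = e}.ncard ≤ c.length := by
      have : {e | ∃ d ∈ c, D.edge d = e} = ((c.map D.edge).toFinset : Set E) := by
        ext e; simp
      rw [this, Set.ncard_coe_finset]
      simpa using List.toFinset_card_le (c.map D.edge)
    have h₂ : {v | b v ≠ v} = (((verts h c).toFinset.erase u : Finset V) : Set V) := by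
      ext v
      simp only [Set.mem_ofPred_eq, Finset.coe_erase, List.coe_toFinset, Set.mem_sdiff,
        Set.mem_singleton_iff]
      constructor
      · intro hv
        refine ⟨hmem v hv, ?_⟩
        rintro rfl
        exact hv (hb v hu)
      · rintro ⟨h₁, h₂⟩ h₃
        exact h₂ (h₃ ▸ hb v h₁)
    rw [h₂, Set.ncard_coe_finset, Finset.card_erase_of_mem (by simpa using hu),
      List.toFinset_card_of_nodup hn]
    have h₃ : (verts h c).length = c.length := by simp [verts]
    -- With `m ≥ 2` vertices on the closed walk there are at most `m` edges and exactly `m - 1`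
    -- moved vertices, and `m ≤ 2 * (m - 1)`.
    have h₄ : 2 ≤ c.length := by
      rw [← h₃, ← List.toFinset_card_of_nodup hn]
      exact Finset.one_lt_card.2 ⟨w, by simpa using hw, u, by simpa using hu, hwu⟩
    omega

end DartSystem

/-! ### Blossom structures: projection of paths, and existence. -/

namespace DartSystem

variable {A E V : Type*} {D : DartSystem A E} {h : A → V × ℤˣ}

variable (D h) in
/-- A blossom partition fixing the root for which the contracted graph is directed: no state other
than the root is reachable with both signs, and the base states of all nontrivial blossoms are
reachable. -/
structure IsBlossomStructure (r : V) (b : V → V) (s : V → ℤˣ) (F : Set E) : Prop extends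
    IsBlossomPartition D h b s F where
  root : ∀ v, b v = r ↔ v = r
  base : ∀ v, b v ≠ v → D.Reach (contract b s ∘ h) r (b v, s (b v))
  unique : ∀ v ε, v ≠ r → D.Reach (contract b s ∘ h) r (v, ε) →
    ¬ D.Reach (contract b s ∘ h) r (v, -ε)

/-- Paths that start in the root project to paths of the contracted graph, and they enter every
nontrivial blossom in its base. -/
theorem IsBlossomStructure.exists_proj {r : V} {b : V → V} {s : V → ℤˣ} {F : Set E}
    (hb : IsBlossomStructure D h r b s F) {γ : ℤˣ} {p : List A} {y : V × ℤˣ}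
    (hp : D.BiPath h (r, γ) p y) :
    ∃ q, q.Sublist p ∧
      ((∃ v, b v = b y.1 ∧ b v ≠ v) →
        D.BiPath (contract b s ∘ h) (r, γ) q (b y.1, s (b y.1)) ∧
        (b y.1 = y.1 → y = (b y.1, s (b y.1)))) ∧
      ((∀ v, b v = b y.1 → b v = v) → D.BiPath (contract b s ∘ h) (r, γ) q y) ∧
      (∀ w ∈ r :: verts h p, b w ∈ r :: verts h p) ∧
      ∀ w ∈ r :: verts (contract b s ∘ h) q, w ∈ r :: verts h p := by
  have hbr : b r = r := (hb.root r).2 rfl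
  induction p using List.reverseRecOn generalizing y with
  | nil =>
    have hy : (r, γ) = y := hp.walk
    subst hy
    refine ⟨[], List.Sublist.refl _, ?_, fun _ => ⟨rfl, by simp⟩, by simp [hbr], by simp⟩
    rintro ⟨v, h₁, h₂⟩
    rw [hbr] at h₁
    exact absurd (h₁.trans ((hb.root v).1 h₁).symm) h₂
  | append_singleton p d ih =>
    have hw := Walk.concat_iff.1 hp.walk
    obtain ⟨hw, rfl⟩ := hw
    obtain ⟨q, hqp, hq₁, hq₂, hq₃, hq₄⟩ := ih (hp.of_append_left hw)
    have hn := hp.nodup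
    rw [verts_append, ← List.cons_append, List.nodup_append'] at hn
    have hdn : (h d).1 ∉ r :: verts h p := by
      simpa [List.disjoint_right] using hn.2.2
    have hT : (D.tail h d).1 ∈ r :: verts h p := BiWalk.end_mem_cons hw
    have hmono : ∀ w ∈ r :: verts h p, w ∈ r :: verts h (p ++ [d]) := by
      intro w hw
      rw [verts_append, ← List.cons_append]
      exact List.mem_append_left _ hw
    have hlast : (h d).1 ∈ r :: verts h (p ++ [d]) := by
      rw [verts_append, ← List.cons_append]
      exact List.mem_append_right _ (by simp)
    -- A dart inside a fibre leaves the projection unchanged. It cannot arrive at the base, which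
    -- the path has already visited by `hq₃`.
    by_cases hint : b (h d).1 = b (D.tail h d).1
    · have hne : (h d).1 ≠ (D.tail h d).1 := fun h' => hdn (h' ▸ hT)
      have hnb : b (h d).1 ≠ (h d).1 := by
        intro h'
        apply hdn
        rw [← h', hint]
        exact hq₃ _ hT
      have hQ := hq₁ ⟨(h d).1, hint, hnb⟩
      refine ⟨q, hqp.trans (List.sublist_append_left _ _), fun _ => ⟨?_, fun h' => absurd h' hnb⟩,
        fun h' => absurd (h' _ rfl) hnb, ?_, fun w hw => hmono w (hq₄ w hw)⟩
      · rw [hint]; exact hQ.1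
      · intro w hw
        rw [verts_append, ← List.cons_append, List.mem_append] at hw
        rcases hw with hw | hw
        · exact hmono _ (hq₃ w hw)
        · obtain rfl : w = (h d).1 := by simpa using hw
          rw [hint]; exact hmono _ (hq₃ _ hT)
    · have hq : D.BiPath (contract b s ∘ h) (r, γ) q (D.tail (contract b s ∘ h) d) := by
        rw [tail_contract]
        by_cases hnt : ∃ v, b v = b (D.tail h d).1 ∧ b v ≠ v
        · obtain ⟨hQ, hQ'⟩ := hq₁ hnt
          by_cases hT' : b (D.tail h d).1 = (D.tail h d).1
          · rw [mate_contract_of_eq hT', hQ' hT']; exact hQ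
          · rw [mate_contract_of_ne hT']; exact hQ
        · push Not at hnt
          rw [mate_contract_of_eq (hnt _ rfl)]
          exact hq₂ hnt
      have hext : ((contract b s ∘ h) d).1 ≠ (D.tail (contract b s ∘ h) d).1 := by
        rw [tail_contract]; simpa using hint
      -- The contracted head of `d` is reachable, and so is the base state of a nontrivial fibre.
      -- Uniqueness of signs thus forces `d` to enter such a fibre in its base state.
      have hreach := hq.reach_head hb.unique hext
      have hhr : (h d).1 ≠ r := fun h' => hdn (by simp [h'])
      have hbhr : b (h d).1 ≠ r := fun h' => hhr ((hb.root _).1 h')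
      have hbase : (∃ v, b v = b (h d).1 ∧ b v ≠ v) →
          h d = (b (h d).1, s (b (h d).1)) := by
        rintro ⟨v, h₁, h₂⟩
        have h₃ := hb.base v h₂
        rw [h₁] at h₃
        have h₄ := hb.unique _ _ hbhr h₃
        by_cases h₅ : b (h d).1 = (h d).1
        · rw [Function.comp_apply, contract_of_eq h₅] at hreach
          rcases eq_or_eq_mate (x := (b (h d).1, s (b (h d).1))) (y := h d) h₅.symm with h₆ | h₆
          · exact h₆
          · rw [h₆] at hreach
            exact absurd hreach h₄
        · rw [Function.comp_apply, contract_of_ne h₅] at hreach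
          exact absurd hreach h₄
      have hfix : b (h d).1 = (h d).1 := by
        by_cases hnt : ∃ v, b v = b (h d).1 ∧ b v ≠ v
        · exact (congrArg Prod.fst (hbase hnt)).symm
        · push Not at hnt
          exact hnt _ rfl
      have hK : (contract b s ∘ h) d = h d := contract_of_eq hfix
      have hpath := hq.concat (d := d) (by
        rw [hK]; exact fun h' => hdn (hq₄ _ h'))
      rw [hK] at hpath
      refine ⟨q ++ [d], hqp.append (List.Sublist.refl _), fun hnt => ?_, fun _ => hpath, ?_, ?_⟩
      · rw [← hbase hnt]; exact ⟨hpath, fun _ => rfl⟩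
      · intro w hw
        rw [verts_append, ← List.cons_append, List.mem_append] at hw
        rcases hw with hw | hw
        · exact hmono _ (hq₃ w hw)
        · obtain rfl : w = (h d).1 := by simpa using hw
          rw [hfix]; exact hlast
      · intro w hw
        rw [verts_append, ← List.cons_append, List.mem_append] at hw
        rcases hw with hw | hw
        · exact hmono _ (hq₄ w hw)
        · obtain rfl : w = (h d).1 := by simpa [hfix] using hw
          exact hlast

/-- A vertex in a nontrivial blossom is the head of a dart. -/
theorem IsBlossomPartition.exists_head {b : V → V} {s : V → ℤˣ} {F : Set E}
    (hb : IsBlossomPartition D h b s F) {v : V} (hv : b v ≠ v) : ∃ d, (h d).1 = v := by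
  obtain ⟨p, hp, -⟩ := hb.reach v hv 1
  have hne : p ≠ [] := by
    rintro rfl
    exact hv (congrArg Prod.fst (show (b v, s (b v)) = (v, 1) from hp.walk))
  obtain ⟨d, -, hd⟩ := List.mem_map.1 (hp.walk.end_mem hne)
  exact ⟨d, hd⟩

/-- The base of a nontrivial blossom is the head of a dart. -/
theorem IsBlossomPartition.exists_head_base {b : V → V} {s : V → ℤˣ} {F : Set E}
    (hb : IsBlossomPartition D h b s F) {v : V} (hv : b v ≠ v) : ∃ d, (h d).1 = b v := by
  obtain ⟨p, hp, -⟩ := hb.reach v hv 1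
  rcases p with _ | ⟨d, p⟩
  · exact absurd (congrArg Prod.fst (show (b v, s (b v)) = (v, 1) from hp.walk)) hv
  · have h₁ : D.tail h d = _ := hp.walk.1
    refine ⟨D.rev d, ?_⟩
    rw [D.head_rev h, h₁]; rfl

/-- A blossom partition of a contracted graph gives a blossom partition of the original graph. -/
theorem IsBlossomPartition.comp [Finite V] {b b' : V → V} {s s' s'' : V → ℤˣ} {F F' : Set E}
    (hb : IsBlossomPartition D h b s F) (hb' : IsBlossomPartition D (contract b s ∘ h) b' s' F')
    (hs : ∀ v, b' v ≠ v → s'' (b' v) = s' (b' v))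
    (hs' : ∀ v, b v ≠ v → b' (b v) = b v → s'' (b v) = s (b v)) :
    IsBlossomPartition D h (b' ∘ b) s'' (F ∪ F') := by
  have hrange : ∀ v, (∃ d, ((contract b s ∘ h) d).1 = v) → b v = v := by
    rintro v ⟨d, rfl⟩
    simpa using hb.idem _
  have hbase : ∀ v, b' v ≠ v → b (b' v) = b' v := fun v hv => hrange _ (hb'.exists_head_base hv)
  have hfix : ∀ v, b (b' (b v)) = b' (b v) := by
    intro v
    by_cases hv : b' (b v) = b v
    · rw [hv, hb.idem]
    · exact hbase _ hv
  have hsep : ∀ v, b' v ≠ v → b v = v := fun v hv => hrange _ (hb'.exists_head hv)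
  refine ⟨?_, ?_, ?_, ?_⟩
  · intro v
    simp only [Function.comp_apply]
    rw [hfix, hb'.idem]
  · intro v hv β
    simp only [Function.comp_apply] at hv ⊢
    by_cases hbv : b' (b v) = b v
    · rw [hbv] at hv ⊢
      rw [hs' v hv hbv]
      obtain ⟨p, hp, hp'⟩ := hb.reach v hv β
      exact ⟨p, hp, fun d hd => ⟨by rw [(hp' d hd).1, hbv], Or.inl (hp' d hd).2⟩⟩
    · rw [hs _ hbv]
      -- The state in which a contracted path has to arrive so that its lift can end in `(v, β)`.
      set y : V × ℤˣ := mate (contract b s (mate (v, β))) with hy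
      have hy₁ : y.1 = b v := by simp [hy]
      obtain ⟨p, hp, hp'⟩ := hb'.reach (b v) hbv y.2
      have hx : contract b s (b' (b v), s' (b' (b v))) = (b' (b v), s' (b' (b v))) :=
        contract_of_eq (hfix v)
      rw [← hx, show (b v, y.2) = y from Prod.ext hy₁.symm rfl, hy] at hp
      obtain ⟨q, hq, hq'⟩ := hb.exists_lift hp
      refine ⟨q, hq, fun d hd => ⟨?_, ?_⟩⟩
      · rcases List.mem_cons.1 (hq' d hd).1 with h₁ | h₁
        · rw [h₁, hfix, hb'.idem]
        · obtain ⟨e, he, h₂⟩ := List.mem_map.1 h₁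
          rw [← h₂, (hp' e he).1]
      · rcases (hq' d hd).2 with h₁ | h₁
        · exact Or.inr (hp' d h₁).2
        · exact Or.inl h₁.1
  · intro v hv
    simp only [Function.comp_apply] at hv ⊢
    -- If the new base already carries a nontrivial inner blossom, the loop of that blossom serves.
    -- Otherwise the outer loop is lifted; its first dart is split off because only the rest is a
    -- path.
    by_cases hnt : ∃ w, b w = b' (b v) ∧ b w ≠ w
    · obtain ⟨w, hw₁, hw₂⟩ := hnt
      obtain ⟨p, hp, hp₁, hp₂⟩ := hb.loop w hw₂
      have h₁ : b' (b w) = b w := by rw [hw₁, hb'.idem]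
      have h₂ := hs' w hw₂ h₁
      rw [← hw₁, h₂]
      exact ⟨p, hp, hp₁, fun d hd => by rw [(hp₂ d hd), h₁]⟩
    · push Not at hnt
      have hbv : b' (b v) ≠ b v := by
        intro h'
        rw [h'] at hv
        exact hv (hnt v h'.symm)
      obtain ⟨p, hp, hp₁, hp₂⟩ := hb'.loop _ hbv
      rw [hs _ hbv]
      rcases p with _ | ⟨d, p⟩
      · exact absurd (congrArg Prod.snd
          (show (b' (b v), s' (b' (b v))) = (b' (b v), -s' (b' (b v))) from hp)).symm
          (Int.units_neg_ne _)
      · have hd : D.tail (contract b s ∘ h) d = _ := hp.1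
        have hdt : D.tail h d = (b' (b v), s' (b' (b v))) := by
          rw [tail_contract] at hd
          have h₁ : b (D.tail h d).1 = b' (b v) := by simpa using congrArg Prod.fst hd
          rwa [mate_contract_of_eq (hnt _ h₁)] at hd
        have hpath : D.BiPath (contract b s ∘ h) (contract b s (h d)) p
            (mate (contract b s (mate (b' (b v), -s' (b' (b v)))))) := by
          rw [mate_contract_of_eq (hfix v)]
          exact ⟨hp.2, hp₁⟩
        obtain ⟨q, hq, hq'⟩ := hb.exists_lift hpath
        refine ⟨d :: q, ⟨hdt, hq.walk⟩, hq.nodup, ?_⟩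
        have hd₀ : b' (b (h d).1) = b' (b v) := by simpa using hp₂ d (by simp)
        intro e he
        rcases List.mem_cons.1 he with rfl | he
        · exact hd₀
        · rcases List.mem_cons.1 (hq' e he).1 with h₁ | h₁
          · rw [h₁]; exact hd₀
          · obtain ⟨f, hf, h₂⟩ := List.mem_map.1 h₁
            rw [← h₂, hp₂ f (by simp [hf])]
  · have hsub : {v | b v ≠ v} ∪ {v | b' v ≠ v} ⊆ {v | (b' ∘ b) v ≠ v} := by
      rintro v (hv | hv)
      · exact fun h' => hv (by rw [← h', Function.comp_apply, hfix])
      · have hv' : b' v ≠ v := hv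
        change b' (b v) ≠ v
        rwa [hsep v hv]
    have hdisj : Disjoint {v | b v ≠ v} {v | b' v ≠ v} :=
      Set.disjoint_left.2 fun v hv hv' => hv (hsep v hv')
    have h₁ := Set.ncard_le_ncard hsub (Set.toFinite _)
    rw [Set.ncard_union_eq hdisj (Set.toFinite _) (Set.toFinite _)] at h₁
    have h₂ := Set.ncard_union_le F F'
    have h₃ := hb.ncard_le
    have h₄ := hb'.ncard_le
    omega

/-- If there is no closed path at the root, then the graph has a blossom structure. -/
theorem exists_isBlossomStructure [Finite V] {r : V} (h : A → V × ℤˣ)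
    (hc : ∀ γ γ' p, p ≠ [] → (verts h p).Nodup → ¬ D.BiWalk h (r, γ) p (r, γ')) :
    ∃ b s F, IsBlossomStructure D h r b s F := by
  classical
  -- Contraction keeps the vertex set, so progress is measured by the vertices at which darts still
  -- arrive. The vertex `w ≠ u` of the blossom drops out.
  induction hk : {v | ∃ d, (h d).1 = v}.ncard using Nat.strong_induction_on generalizing h with
  | _ k ih =>
  by_cases hu : ∀ v ε, v ≠ r → D.Reach h r (v, ε) → ¬ D.Reach h r (v, -ε)
  · refine ⟨id, fun _ => 1, ∅, ⟨⟨by simp, by simp, by simp, by simp⟩, by simp, by simp, ?_⟩⟩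
    have : contract id (fun _ => 1) ∘ h = h := funext fun d => contract_of_eq rfl
    rwa [this]
  push Not at hu
  obtain ⟨v, ε, hv, ⟨γ, p₀, hp₀⟩, ⟨γ', q₀, hq₀⟩⟩ := hu
  obtain ⟨u, α, p, c, hur, hp, hcyc, hcn, hpc, w, hw, hwu⟩ := exists_cycle hc hv hp₀ hq₀
  have hcne : c ≠ [] := by rintro rfl; simp at hw
  have huc : u ∈ verts h c := hcyc.end_mem hcne
  have hrc : r ∉ verts h c := fun h' => hur (hpc r h' (by simp)).symm
  set b : V → V := fun v => if v ∈ verts h c then u else v with hb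
  have hb₁ : ∀ v ∈ verts h c, b v = u := fun v hv => if_pos hv
  have hb₂ : ∀ v ∉ verts h c, b v = v := fun v hv => if_neg hv
  have hbu : b u = u := hb₁ u huc
  have hbe : ∀ v, b v ≠ v → b v = u := fun v hv => by
    by_contra h'
    exact hv (hb₂ v fun h'' => h' (hb₁ v h''))
  set s : V → ℤˣ := fun _ => α with hs
  have hP := isBlossomPartition_cycle hcyc hcn ⟨w, hw, hwu⟩ hb₁ hb₂
  have hroot : ∀ v, b v = r ↔ v = r := by
    intro v
    by_cases hv : v ∈ verts h c
    · rw [hb₁ v hv]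
      exact ⟨fun h' => absurd h' hur, fun h' => absurd (h' ▸ hv) hrc⟩
    · rw [hb₂ v hv]
  have hlt : {v | ∃ d, ((contract b s ∘ h) d).1 = v}.ncard < k := by
    rw [← hk]
    refine Set.ncard_lt_ncard (Set.ssubset_iff_of_subset ?_ |>.2 ⟨w, ?_, ?_⟩) (Set.toFinite _)
    · rintro _ ⟨d, rfl⟩
      by_cases hd : b (h d).1 = (h d).1
      · exact ⟨d, by simp [hd]⟩
      · obtain ⟨e, -, he⟩ := List.mem_map.1 huc
        exact ⟨e, by rw [he]; simp [hbe _ hd]⟩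
    · obtain ⟨e, -, he⟩ := List.mem_map.1 hw
      exact ⟨e, he⟩
    · rintro ⟨d, hd⟩
      rw [Function.comp_apply, contract_fst] at hd
      have := hP.idem (h d).1
      rw [hd, hb₁ w hw] at this
      exact hwu this.symm
  have hc' : ∀ γ γ' p, p ≠ [] → (verts (contract b s ∘ h) p).Nodup →
      ¬ D.BiWalk (contract b s ∘ h) (r, γ) p (r, γ') := by
    intro γ γ' p hne hn hp
    rcases p with _ | ⟨d, p⟩
    · exact hne rfl
    have hbr : b r = r := (hroot r).2 rfl
    have ht : D.tail (contract b s ∘ h) d = (r, γ) := hp.1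
    have ht' : D.tail h d = (r, γ) := by
      rw [tail_contract] at ht
      have h₁ : b (D.tail h d).1 = r := by simpa using congrArg Prod.fst ht
      rwa [mate_contract_of_eq (by rw [h₁, ((hroot _).1 h₁)])] at ht
    have hpath : D.BiPath (contract b s ∘ h) (contract b s (h d)) p
        (mate (contract b s (mate (r, γ')))) := by
      rw [mate_contract_of_eq hbr]
      exact ⟨hp.2, hn⟩
    obtain ⟨q, hq, -⟩ := hP.exists_lift hpath
    exact hc γ γ' (d :: q) (by simp) hq.nodup ⟨ht', hq.walk⟩
  obtain ⟨b', s', F', hS⟩ := ih _ hlt (contract b s ∘ h) hc' rfl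
  have hp' : D.BiPath (contract b s ∘ h) (r, γ) p (u, α) := by
    refine hp.contract fun v hv => ?_
    by_cases hvc : v ∈ verts h c
    · rw [hpc v hvc hv, hbu]
    · exact hb₂ v hvc
  obtain ⟨q, -, hq₁, hq₂, -⟩ := hS.exists_proj hp'
  -- The base sign of the new blossom must be recorded even if `b'` has no nontrivial fibre at `u`.
  -- If `u` is the base of one, the projected path to `(u, α)` enters in the base state, so `s' u`
  -- is already `α`.
  set s'' : V → ℤˣ := Function.update s' u α with hs''
  have hsu : ∀ v, b' v ≠ v → b' v = u → s' u = α := by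
    intro v hv hvu
    have hbb : b' u = u := by rw [← hvu, hS.idem]
    have := (hq₁ ⟨v, by rw [hvu, hbb], hv⟩).2 hbb
    rw [hbb] at this
    exact (congrArg Prod.snd this).symm
  have hss : ∀ v, b' v ≠ v → s'' (b' v) = s' (b' v) := by
    intro v hv
    by_cases hvu : b' v = u
    · rw [hs'', hvu, Function.update_self, hsu v hv hvu]
    · rw [hs'', Function.update_of_ne hvu]
  have hss' : ∀ v, b v ≠ v → b' (b v) = b v → s'' (b v) = s (b v) := by
    intro v hv _
    rw [hbe v hv, hs'', Function.update_self]
  -- Contracting in two stages amounts to a single contraction, so reachability and uniqueness carry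
  -- over from the induction hypothesis.
  have hK : contract (b' ∘ b) s'' ∘ h = contract b' s' ∘ (contract b s ∘ h) := by
    funext d
    simp only [Function.comp_apply]
    by_cases h₁ : b (h d).1 = (h d).1
    · rw [contract_of_eq h₁]
      by_cases h₂ : b' (h d).1 = (h d).1
      · rw [contract_of_eq h₂, contract_of_eq (by simp [h₁, h₂])]
      · rw [contract_of_ne h₂, contract_of_ne (by simpa [h₁] using h₂)]
        simp only [Function.comp_apply]
        rw [h₁, hss _ h₂]
    · have hbd := hbe _ h₁
      have hne : (b' ∘ b) (h d).1 ≠ (h d).1 := by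
        rw [Function.comp_apply, hbd]
        intro h'
        by_cases h₃ : b' u = u
        · exact h₁ (by rw [hbd, ← h', h₃])
        · obtain ⟨e, he⟩ := hS.exists_head_base h₃
          rw [h', Function.comp_apply, contract_fst] at he
          apply h₁
          rw [← he, hP.idem]
      rw [contract_of_ne h₁, contract_of_ne hne, Function.comp_apply, hbd]
      by_cases h₃ : b' u = u
      · rw [contract_of_eq (by exact h₃), h₃, hs'', Function.update_self]
      · rw [contract_of_ne (by exact h₃), hss u h₃]
  refine ⟨b' ∘ b, s'', _, ⟨hP.comp hS.toIsBlossomPartition hss hss', ?_, ?_, ?_⟩⟩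
  · intro v
    rw [Function.comp_apply, hS.root, hroot]
  · intro v hv
    rw [hK]
    simp only [Function.comp_apply] at hv ⊢
    by_cases h₁ : b' (b v) = b v
    · rw [h₁] at hv ⊢
      rw [hss' v hv h₁]
      rw [hbe v hv] at h₁ ⊢
      by_cases hnt : ∃ v, b' v = b' u ∧ b' v ≠ v
      · have := hq₁ hnt
        rw [this.2 h₁]
        exact ⟨γ, q, this.1⟩
      · push Not at hnt
        exact ⟨γ, q, hq₂ hnt⟩
    · rw [hss _ h₁]
      exact hS.base _ h₁
  · rw [hK]
    exact hS.unique

end DartSystem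

/-! ### Unit-capacity flows and the arc version of Menger's theorem. -/

namespace Digraph

open scoped Classical in
/-- The number of arcs in `J` that enter the vertex set `X`. -/
noncomputable def inCut {A V : Type*} (tl hd : A → V) (J : Finset A) (X : Set V) : ℕ :=
  (J.filter fun a => tl a ∉ X ∧ hd a ∈ X).card

open scoped Classical in
/-- The net number of arcs in `f` that enter the vertex set `X`. -/
noncomputable def net {A V : Type*} (tl hd : A → V) (f : Finset A) (X : Set V) : ℤ :=
  ∑ a ∈ f, ((if hd a ∈ X then 1 else 0) - (if tl a ∈ X then 1 else 0))

variable {A V : Type*} {tl hd : A → V}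

/-- The vertices that can be reached from `x` by paths with arcs in `R`. -/
def reachable (tl hd : A → V) (R : Set A) (x : V) : Set V :=
  {w | ∃ p, Walk tl hd x p w ∧ (x :: p.map hd).Nodup ∧ ∀ a ∈ p, a ∈ R}

theorem self_mem_reachable (R : Set A) (x : V) : x ∈ reachable tl hd R x :=
  ⟨[], rfl, by simp, by simp⟩

theorem head_mem_reachable {R : Set A} {x : V} {a : A} (ha : a ∈ R)
    (ht : tl a ∈ reachable tl hd R x) : hd a ∈ reachable tl hd R x := by
  obtain ⟨p, hp, hn, hR⟩ := ht
  by_cases hm : hd a ∈ x :: p.map hd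
  · obtain ⟨p₁, p₂, z, rfl, h₁, -, h₃⟩ := Walk.exists_split (f := id) hp hm
    obtain rfl : z = hd a := h₃
    rw [List.map_append, ← List.cons_append] at hn
    exact ⟨p₁, h₁, hn.of_append_left, fun b hb => hR b (by simp [hb])⟩
  · refine ⟨p ++ [a], Walk.concat_iff.2 ⟨hp, rfl⟩, ?_, ?_⟩
    · rw [List.map_append, ← List.cons_append, List.nodup_append']
      exact ⟨hn, by simp, by simpa [List.disjoint_right] using hm⟩
    · intro b hb
      rcases List.mem_append.1 hb with hb | hb
      · exact hR b hb
      · rw [List.mem_singleton.1 hb]; exact ha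

/-- If all arcs of `J` that enter `X` are in `f` and no arc of `f` leaves `X`, then the net flow
into `X` is the size of the cut. -/
theorem net_eq_inCut {J f : Finset A} (hf : f ⊆ J) {X : Set V}
    (h₁ : ∀ a ∈ J, tl a ∉ X → hd a ∈ X → a ∈ f) (h₂ : ∀ a ∈ f, tl a ∈ X → hd a ∈ X) :
    net tl hd f X = inCut tl hd J X := by
  classical
  have hfil : J.filter (fun a => tl a ∉ X ∧ hd a ∈ X) =
      f.filter (fun a => tl a ∉ X ∧ hd a ∈ X) := by
    ext a
    simp only [Finset.mem_filter]
    exact ⟨fun h => ⟨h₁ a h.1 h.2.1 h.2.2, h.2⟩, fun h => ⟨hf h.1, h.2⟩⟩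
  unfold net inCut
  rw [hfil, Finset.card_filter, Nat.cast_sum]
  refine Finset.sum_congr rfl fun a ha => ?_
  by_cases ht : tl a ∈ X
  · simp [ht, h₂ a ha ht]
  · by_cases hh : hd a ∈ X <;> simp [ht, hh]

open scoped Classical in
/-- A set of arcs is changed along a residual path. -/
theorem exists_augment {J : Finset A} {v : V} (p : List (A × Bool)) :
    ∀ f ⊆ J, ∀ w, Walk (fun a => if a.2 then tl a.1 else hd a.1)
      (fun a => if a.2 then hd a.1 else tl a.1) w p v → p.Nodup →
      (∀ a ∈ p, (a.2 = true → a.1 ∈ J ∧ a.1 ∉ f) ∧ (a.2 = false → a.1 ∈ f)) →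
      ∃ f' ⊆ J, ∀ X : Set V, net tl hd f' X =
        net tl hd f X + ((if v ∈ X then 1 else 0) - (if w ∈ X then 1 else 0)) := by
  induction p with
  | nil =>
    intro f hf w hw _ _
    obtain rfl : w = v := hw
    exact ⟨f, hf, by simp⟩
  | cons d p ih =>
    rintro f hf w ⟨rfl, hw⟩ hn hR
    obtain ⟨hdp, hn'⟩ := List.nodup_cons.1 hn
    obtain ⟨a, o⟩ := d
    cases o with
    | true =>
      have ha := (hR _ List.mem_cons_self).1 rfl
      obtain ⟨f', hf', hnet⟩ := ih (insert a f) (Finset.insert_subset ha.1 hf) _ hw hn' (by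
        rintro ⟨c, o⟩ hc
        have := hR _ (List.mem_cons_of_mem _ hc)
        refine ⟨fun ho => ⟨(this.1 ho).1, ?_⟩, fun ho => Finset.mem_insert_of_mem (this.2 ho)⟩
        rw [Finset.mem_insert]
        rintro (h | h)
        · simp only at h ho
          subst h ho
          exact hdp hc
        · exact (this.1 ho).2 h)
      refine ⟨f', hf', fun X => ?_⟩
      have h₁ : net tl hd (insert a f) X = net tl hd f X +
          ((if hd a ∈ X then 1 else 0) - (if tl a ∈ X then 1 else 0)) := by
        unfold net
        rw [Finset.sum_insert ha.2, add_comm]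
      rw [hnet, h₁]
      simp only [if_true]
      ring
    | false =>
      have ha := (hR _ List.mem_cons_self).2 rfl
      obtain ⟨f', hf', hnet⟩ := ih (f.erase a) ((Finset.erase_subset _ _).trans hf) _ hw hn' (by
        rintro ⟨c, o⟩ hc
        have := hR _ (List.mem_cons_of_mem _ hc)
        refine ⟨fun ho => ⟨(this.1 ho).1, fun h => (this.1 ho).2 (Finset.mem_of_mem_erase h)⟩,
          fun ho => Finset.mem_erase.2 ⟨?_, this.2 ho⟩⟩
        rintro h
        simp only at h ho
        subst h ho
        exact hdp hc)
      refine ⟨f', hf', fun X => ?_⟩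
      have h₁ : net tl hd f X = net tl hd (f.erase a) X +
          ((if hd a ∈ X then 1 else 0) - (if tl a ∈ X then 1 else 0)) := by
        unfold net
        rw [Finset.sum_erase_add _ _ ha]
      rw [hnet, h₁]
      simp only [if_false, Bool.false_eq_true]
      ring

open scoped Classical in
/-- If all cuts between `r` and `v` have at least `k` arcs, then there is an integral flow of value
`k` from `r` to `v`. -/
theorem exists_flow {J : Finset A} {r v : V} {k : ℕ}
    (hk : ∀ X : Set V, v ∈ X → r ∉ X → k ≤ inCut tl hd J X) :
    ∃ f ⊆ J, ∀ X : Set V, net tl hd f X =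
      k * ((if v ∈ X then 1 else 0) - (if r ∈ X then 1 else 0)) := by
  -- The identity for all `X` encodes both flow conservation and the value of the flow, and an
  -- augmentation preserves it additively.
  induction k with
  | zero => exact ⟨∅, by simp, by simp [net]⟩
  | succ k ih =>
    obtain ⟨f, hf, hnet⟩ := ih fun X hv hr => (Nat.le_succ k).trans (hk X hv hr)
    -- The residual arcs: unused arcs forwards (`true`), used arcs backwards (`false`).
    set R : Set (A × Bool) :=
      {a | (a.2 = true → a.1 ∈ J ∧ a.1 ∉ f) ∧ (a.2 = false → a.1 ∈ f)} with hR
    set S := reachable (fun a : A × Bool => if a.2 then tl a.1 else hd a.1)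
      (fun a => if a.2 then hd a.1 else tl a.1) R r with hS
    have hrS : r ∈ S := self_mem_reachable _ _
    by_cases hv : v ∈ S
    · obtain ⟨p, hp, hn, hpR⟩ := hv
      obtain ⟨f', hf', hnet'⟩ := exists_augment p f hf r hp (List.Nodup.of_map _ hn.of_cons) hpR
      refine ⟨f', hf', fun X => ?_⟩
      rw [hnet', hnet]
      push_cast
      ring
    · exfalso
      -- Without an augmenting path, the cut around the residually unreachable set is saturated, so
      -- it has only `k` arcs.
      have h₁ := net_eq_inCut (tl := tl) (hd := hd) hf (X := Sᶜ) (by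
        intro a ha ht hh
        by_contra haf
        exact hh (head_mem_reachable (a := (a, true)) (R := R)
          (by simp [hR, ha, haf]) (by simpa using ht))) (by
        intro a ha ht hh
        exact ht (head_mem_reachable (a := (a, false)) (R := R)
          (by simp [hR, ha]) (by simpa using hh)))
      have h₂ := hk Sᶜ hv (by simpa using hrS)
      rw [hnet] at h₁
      simp only [Set.mem_compl_iff, hv, hrS, not_true_eq_false, not_false_eq_true, if_true,
        if_false] at h₁
      omega

theorem net_walk [DecidableEq A] {x y : V} {p : List A} (hp : Walk tl hd x p y) (hn : p.Nodup)
    (X : Set V) [Decidable (x ∈ X)] [Decidable (y ∈ X)] : net tl hd p.toFinset X =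
      (if y ∈ X then 1 else 0) - (if x ∈ X then 1 else 0) := by
  classical
  induction p generalizing x with
  | nil =>
    obtain rfl : x = y := hp
    simp only [List.toFinset_nil, net, Finset.sum_empty]
    split_ifs <;> simp
  | cons d p ih =>
    obtain ⟨rfl, hp⟩ := hp
    obtain ⟨hdp, hn⟩ := List.nodup_cons.1 hn
    have := ih hp hn
    unfold net at this ⊢
    rw [List.toFinset_cons, Finset.sum_insert (by simpa using hdp), this]
    ring_nf

open scoped Classical in
/-- An integral flow of value `k` contains `k` arc-disjoint paths. -/
theorem exists_paths_of_flow {r v : V} {k : ℕ} {f : Finset A}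
    (hf : ∀ X : Set V, net tl hd f X =
      k * ((if v ∈ X then 1 else 0) - (if r ∈ X then 1 else 0))) :
    ∃ P : Fin k → List A, (∀ i, Walk tl hd r (P i) v ∧ (r :: (P i).map hd).Nodup ∧
      ∀ a ∈ P i, a ∈ f) ∧ Pairwise fun i j => List.Disjoint (P i) (P j) := by
  induction k generalizing f with
  | zero => exact ⟨fun i => i.elim0, fun i => i.elim0, fun i => i.elim0⟩
  | succ k ih =>
    set S := reachable tl hd (f : Set A) r with hS
    have hrS : r ∈ S := self_mem_reachable _ _
    have hv : v ∈ S := by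
      by_contra hv
      have h₁ := hf Sᶜ
      simp only [Set.mem_compl_iff, hv, hrS, not_true_eq_false, not_false_eq_true, if_true,
        if_false] at h₁
      -- No arc of `f` leaves the reachable set, which contradicts a positive flow value.
      have h₂ : net tl hd f Sᶜ ≤ 0 := by
        refine Finset.sum_nonpos fun a ha => ?_
        by_cases ht : tl a ∈ S
        · simp [ht, show hd a ∈ S from head_mem_reachable ha ht]
        · by_cases hh : hd a ∈ S <;> simp [ht, hh]
      push_cast at h₁
      omega
    obtain ⟨p, hp, hn, hpf⟩ := hv
    have hnp : p.Nodup := List.Nodup.of_map _ hn.of_cons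
    have hsub : p.toFinset ⊆ f := fun a ha => hpf a (by simpa using ha)
    obtain ⟨P, hP, hP'⟩ := ih (f := f \ p.toFinset) fun X => by
      have h₁ : net tl hd (f \ p.toFinset) X + net tl hd p.toFinset X = net tl hd f X :=
        Finset.sum_sdiff hsub
      rw [hf, net_walk hp hnp] at h₁
      push_cast at h₁
      linarith
    have hdis : ∀ i, List.Disjoint p (P i) := fun i a ha ha' => by
      have := (hP i).2.2 a ha'
      simp [ha] at this
    refine ⟨Fin.cons p P, fun i => ?_, ?_⟩
    · induction i using Fin.cases with
      | zero => exact ⟨hp, hn, hpf⟩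
      | succ i => exact ⟨(hP i).1, (hP i).2.1, fun a ha => (Finset.mem_sdiff.1 ((hP i).2.2 a ha)).1⟩
    · intro i j hij
      induction i using Fin.cases with
      | zero =>
        induction j using Fin.cases with
        | zero => exact absurd rfl hij
        | succ j => exact hdis j
      | succ i =>
        induction j using Fin.cases with
        | zero => exact (hdis i).symm
        | succ j => exact hP' fun h : i = j => hij (congrArg Fin.succ h)

/-- The arc version of Menger's theorem. -/
theorem exists_disjoint_paths {J : Finset A} {r v : V} {k : ℕ}
    (hk : ∀ X : Set V, v ∈ X → r ∉ X → k ≤ inCut tl hd J X) :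
    ∃ P : Fin k → List A, (∀ i, Walk tl hd r (P i) v ∧ (r :: (P i).map hd).Nodup ∧
      ∀ a ∈ P i, a ∈ J) ∧ Pairwise fun i j => List.Disjoint (P i) (P j) := by
  obtain ⟨f, hf, hnet⟩ := exists_flow hk
  obtain ⟨P, hP, hP'⟩ := exists_paths_of_flow hnet
  exact ⟨P, fun i => ⟨(hP i).1, (hP i).2.1, fun a ha => hf ((hP i).2.2 a ha)⟩, hP'⟩

/-- A walk that starts outside of `X` and ends in `X` contains an arc that enters `X`. -/
theorem exists_mem_enter {x y : V} {p : List A} (hp : Walk tl hd x p y) {X : Set V} (hx : x ∉ X)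
    (hy : y ∈ X) : ∃ a ∈ p, tl a ∉ X ∧ hd a ∈ X := by
  induction p generalizing x with
  | nil => exact absurd (show x = y from hp) (fun h => hx (h ▸ hy))
  | cons d p ih =>
    obtain ⟨rfl, hp⟩ := hp
    by_cases hd' : hd d ∈ X
    · exact ⟨d, by simp, hx, hd'⟩
    · obtain ⟨a, ha, h⟩ := ih hp hd'
      exact ⟨a, by simp [ha], h⟩

/-! ### Minimum cuts and Lovász's flame theorem. -/

/-- The smallest size of a cut between `r` and `v`. -/
noncomputable def minCut (tl hd : A → V) (J : Finset A) (r v : V) : ℕ :=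
  sInf {n | ∃ X : Set V, v ∈ X ∧ r ∉ X ∧ inCut tl hd J X = n}

theorem minCut_le {J : Finset A} {r v : V} {X : Set V} (hv : v ∈ X) (hr : r ∉ X) :
    minCut tl hd J r v ≤ inCut tl hd J X := Nat.sInf_le ⟨X, hv, hr, rfl⟩

theorem exists_inCut_eq_minCut (J : Finset A) {r v : V} (hvr : v ≠ r) :
    ∃ X : Set V, v ∈ X ∧ r ∉ X ∧ inCut tl hd J X = minCut tl hd J r v :=
  Nat.sInf_mem (s := {n | ∃ X : Set V, v ∈ X ∧ r ∉ X ∧ inCut tl hd J X = n})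
    ⟨_, {v}, rfl, fun h => hvr h.symm, rfl⟩

theorem inCut_inter_add_inCut_union_le (J : Finset A) (X Y : Set V) :
    inCut tl hd J (X ∩ Y) + inCut tl hd J (X ∪ Y) ≤ inCut tl hd J X + inCut tl hd J Y := by
  classical
  simp only [inCut, Finset.card_filter, ← Finset.sum_add_distrib]
  refine Finset.sum_le_sum fun a _ => ?_
  by_cases h₁ : tl a ∈ X <;> by_cases h₂ : tl a ∈ Y <;> by_cases h₃ : hd a ∈ X <;>
    by_cases h₄ : hd a ∈ Y <;> simp [h₁, h₂, h₃, h₄]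

theorem inCut_mono {J J' : Finset A} (h : J' ⊆ J) (X : Set V) :
    inCut tl hd J' X ≤ inCut tl hd J X := by
  classical
  exact Finset.card_le_card (Finset.filter_subset_filter _ h)

theorem eq_of_inCut_le_one {J : Finset A} {X : Set V} (hJ : inCut tl hd J X ≤ 1) {a c : A}
    (ha : a ∈ J) (hc : c ∈ J) (ha' : tl a ∉ X ∧ hd a ∈ X) (hc' : tl c ∉ X ∧ hd c ∈ X) : a = c := by
  classical
  exact Finset.card_le_one.1 hJ a (Finset.mem_filter.2 ⟨ha, ha'⟩) c (Finset.mem_filter.2 ⟨hc, hc'⟩)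

theorem inCut_eq_zero {J : Finset A} {X : Set V} (hJ : ∀ a ∈ J, hd a ∉ X) :
    inCut tl hd J X = 0 := by
  classical
  exact Finset.card_eq_zero.2 (Finset.filter_eq_empty_iff.2 fun a ha h' => hJ a ha h'.2)

theorem card_filter_head_le_inCut [DecidableEq V] {J : Finset A} (hJ : ∀ a ∈ J, tl a ≠ hd a)
    (v : V) : (J.filter fun a => hd a = v).card ≤ inCut tl hd J {v} := by
  classical
  obtain ⟨X, hX⟩ : ∃ X : Set V, X = {v} := ⟨_, rfl⟩
  rw [← hX]
  refine Finset.card_le_card fun a ha => ?_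
  obtain ⟨ha, hav⟩ := Finset.mem_filter.1 ha
  refine Finset.mem_filter.2 ⟨ha, fun h' => hJ a ha ?_, hX ▸ hav⟩
  rw [hX] at h'
  exact Eq.trans h' hav.symm

/-- Lovász's theorem: every rooted digraph has a spanning subgraph with the same local
arc-connectivities from the root in which the indegree of every vertex is equal to its local
connectivity. -/
theorem exists_flame [Finite V] (tl hd : A → V) (J : Finset A) (r : V) :
    ∃ J' ⊆ J, ∀ v, v ≠ r → minCut tl hd J' r v = minCut tl hd J r v ∧
      inCut tl hd J' {v} = minCut tl hd J r v := by
  classical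
  induction hk : J.card using Nat.strong_induction_on generalizing J with
  | _ k ih =>
  by_cases hflame : ∀ v, v ≠ r → inCut tl hd J {v} = minCut tl hd J r v
  · exact ⟨J, Finset.Subset.refl _, fun v hv => ⟨rfl, hflame v hv⟩⟩
  push Not at hflame
  obtain ⟨v, hvr, hv⟩ := hflame
  have hle : minCut tl hd J r v ≤ inCut tl hd J {v} := minCut_le rfl fun h => hvr h.symm
  -- An inclusion-minimal tight set for `v`. As the indegree of `v` exceeds the size of this cut,
  -- some arc into `v` starts inside `X`, and this arc can be deleted.
  obtain ⟨X, hX⟩ := (Set.toFinite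
    {X : Set V | v ∈ X ∧ r ∉ X ∧ inCut tl hd J X = minCut tl hd J r v}).exists_minimal
    (exists_inCut_eq_minCut J hvr)
  obtain ⟨hvX, hrX, hXc⟩ := hX.1
  have hex : ∃ a ∈ J, hd a = v ∧ tl a ∈ X := by
    by_contra hcon
    push Not at hcon
    have : inCut tl hd J {v} ≤ inCut tl hd J X := by
      refine Finset.card_le_card fun a ha => ?_
      simp only [Finset.mem_filter, Set.mem_singleton_iff] at ha ⊢
      exact ⟨ha.1, hcon a ha.1 ha.2.2, by rw [ha.2.2]; exact hvX⟩
    omega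
  obtain ⟨a, haJ, hav, haX⟩ := hex
  have hmc : ∀ w, w ≠ r → minCut tl hd (J.erase a) r w = minCut tl hd J r w := by
    intro w hw
    apply le_antisymm
    · obtain ⟨Y, h₁, h₂, h₃⟩ := exists_inCut_eq_minCut (tl := tl) (hd := hd) J hw
      rw [← h₃]
      exact (minCut_le h₁ h₂).trans (inCut_mono (Finset.erase_subset _ _) Y)
    · obtain ⟨Y, h₁, h₂, h₃⟩ := exists_inCut_eq_minCut (tl := tl) (hd := hd) (J.erase a) hw
      rw [← h₃]
      by_cases haY : tl a ∉ Y ∧ hd a ∈ Y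
      · have h₄ : inCut tl hd J Y ≤ inCut tl hd (J.erase a) Y + 1 := by
          unfold inCut
          rw [Finset.filter_erase]
          have := Finset.pred_card_le_card_erase (a := a) (s := J.filter fun a => tl a ∉ Y ∧ hd a ∈ Y)
          omega
        have h₅ := inCut_inter_add_inCut_union_le (tl := tl) (hd := hd) J X Y
        have h₆ : minCut tl hd J r w ≤ inCut tl hd J (X ∪ Y) :=
          minCut_le (Or.inr h₁) (fun h => h.elim hrX h₂)
        have hvY : v ∈ Y := hav ▸ haY.2
        have h₇ : minCut tl hd J r v ≤ inCut tl hd J (X ∩ Y) :=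
          minCut_le ⟨hvX, hvY⟩ (fun h => hrX h.1)
        -- If deleting `a` lowered the connectivity to `w`, then `Y` would be tight for `w` in `J`.
        -- Submodularity makes `X ∩ Y` tight for `v`, but it omits the tail of `a`, contrary to
        -- minimality.
        by_contra hlt
        have h₈ := hX.2 (y := X ∩ Y) ⟨⟨hvX, hvY⟩, fun h => hrX h.1, by omega⟩
          Set.inter_subset_left
        exact haY.1 (h₈ haX).2
      · have : inCut tl hd (J.erase a) Y = inCut tl hd J Y := by
          unfold inCut
          rw [Finset.filter_erase, Finset.erase_eq_of_notMem]
          simp only [Finset.mem_filter, not_and]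
          exact fun _ h h' => haY ⟨h, h'⟩
        rw [this]
        exact minCut_le h₁ h₂
  obtain ⟨J', hJ', hfl⟩ := ih (J.erase a).card
    (by rw [← hk]; exact Finset.card_erase_lt_of_mem haJ) (J.erase a) rfl
  refine ⟨J', hJ'.trans (Finset.erase_subset _ _), fun w hw => ?_⟩
  rw [← hmc w hw]
  exact hfl w hw

end Digraph

/-! ### Edge-disjoint paths and the digraph of root arcs. -/

namespace DartSystem

variable {A E V : Type*} {D : DartSystem A E} {h : A → V × ℤˣ}

open Digraph

variable (D h) in
/-- `n` edge-disjoint paths from `r` to `y` with edges in `F`. -/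
def HasDisjointPaths (r : V) (F : Set E) (n : ℕ) (y : V × ℤˣ) : Prop :=
  ∃ Q : Fin n → List A, (∀ i, (∃ γ, D.BiPath h (r, γ) (Q i) y) ∧ ∀ d ∈ Q i, D.edge d ∈ F) ∧
    Pairwise fun i j => List.Disjoint ((Q i).map D.edge) ((Q j).map D.edge)

variable (D h) in
/-- There is no closed trail at `r`. -/
def NoRootTrail (r : V) : Prop :=
  ∀ γ γ' p, p ≠ [] → D.BiWalk h (r, γ) p (r, γ') → (p.map D.edge).Nodup →
    r ∉ (verts h p).dropLast → False

variable (D h) in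
/-- The non-loops with a head different from `r` that leave a reachable state. -/
def rootArcs (r : V) : Set A :=
  {a | D.Reach h r (D.tail h a) ∧ (D.tail h a).1 ≠ (h a).1 ∧ (h a).1 ≠ r}

theorem BiPath.mem_rootArcs {r : V} {γ : ℤˣ} {p : List A} {y : V × ℤˣ}
    (hp : D.BiPath h (r, γ) p y) {a : A} (ha : a ∈ p) : a ∈ D.rootArcs h r := by
  obtain ⟨p₁, p₂, rfl⟩ := List.append_of_mem ha
  obtain ⟨z, h₁, h₂⟩ := Walk.append_iff.1 hp.walk
  obtain rfl : D.tail h a = z := h₂.1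
  have hn := hp.nodup
  rw [verts_append, ← List.cons_append, List.nodup_append'] at hn
  have ha' : (h a).1 ∉ r :: verts h p₁ := List.disjoint_right.1 hn.2.2 (by simp)
  refine ⟨⟨γ, p₁, hp.of_append_left h₁⟩, fun h' => ha' ?_, fun h' => ha' (by simp [h'])⟩
  rw [← h']
  exact BiWalk.end_mem_cons h₁

section Directed

variable {r : V} (hu : ∀ v ε, v ≠ r → D.Reach h r (v, ε) → ¬ D.Reach h r (v, -ε))
include hu

theorem reach_head_of_mem_rootArcs {a : A} (ha : a ∈ D.rootArcs h r) : D.Reach h r (h a) := by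
  obtain ⟨⟨γ, p, hp⟩, h₁, -⟩ := ha
  exact hp.reach_head hu h₁.symm

theorem eq_of_reach {x y : V × ℤˣ} (hx : D.Reach h r x) (hy : D.Reach h r y) (hxy : x.1 = y.1)
    (hr : y.1 ≠ r) : x = y := by
  rcases eq_or_eq_mate hxy with rfl | rfl
  · rfl
  · exact absurd hx (hu y.1 y.2 hr hy)

/-- If both orientations of an edge were root arcs, the head of one would be reachable with both
signs. -/
theorem injOn_edge_rootArcs : Set.InjOn D.edge (D.rootArcs h r) := by
  intro a ha c hc hac
  rcases D.eq_or_eq_rev hac with rfl | rfl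
  · rfl
  · exfalso
    have h₁ := ha.1
    rw [tail_rev] at h₁
    exact hu _ _ hc.2.2 (reach_head_of_mem_rootArcs hu hc) h₁

theorem biWalk_of_walk {x : V × ℤˣ} {p : List A} {v : V}
    (hp : Walk (fun a => (D.tail h a).1) (fun a => (h a).1) x.1 p v)
    (hpa : ∀ a ∈ p, a ∈ D.rootArcs h r) (hx : D.Reach h r x) (hxr : x.1 ≠ r) :
    ∃ ε, D.BiWalk h x p (v, ε) := by
  induction p generalizing x with
  | nil =>
    obtain rfl : x.1 = v := hp
    exact ⟨x.2, rfl⟩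
  | cons d p ih =>
    have hd := hpa d (by simp)
    obtain ⟨ε, hε⟩ := ih hp.2 (fun a ha => hpa a (by simp [ha]))
      (reach_head_of_mem_rootArcs hu hd) hd.2.2
    exact ⟨ε, eq_of_reach hu hd.1 hx hp.1 hxr, hε⟩

/-- At `r` any initial sign is allowed, so it is read off from the first arc. Afterwards uniqueness
of the reachable sign makes consecutive arcs fit together. -/
theorem biPath_of_walk {p : List A} {v : V} (hv : v ≠ r)
    (hp : Walk (fun a => (D.tail h a).1) (fun a => (h a).1) r p v)
    (hn : (r :: p.map fun a => (h a).1).Nodup) (hpa : ∀ a ∈ p, a ∈ D.rootArcs h r) :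
    ∃ γ ε, D.BiPath h (r, γ) p (v, ε) := by
  rcases p with _ | ⟨d, p⟩
  · exact absurd (show r = v from hp).symm hv
  · have hd := hpa d (by simp)
    obtain ⟨ε, hε⟩ := biWalk_of_walk hu hp.2 (fun a ha => hpa a (by simp [ha]))
      (reach_head_of_mem_rootArcs hu hd) hd.2.2
    exact ⟨(D.tail h d).2, ε, ⟨Prod.ext hp.1 rfl, hε⟩, hn⟩

omit hu in
-- The easy half of Menger's theorem: disjoint paths cross a smallest cut in distinct arcs.
theorem le_minCut {J : Finset A} (hJ : ∀ a, a ∈ J ↔ a ∈ D.rootArcs h r) {n : ℕ}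
    {P : Fin n → List A} {y : V × ℤˣ} (hy : y.1 ≠ r)
    (hP : ∀ i, ∃ γ, D.BiPath h (r, γ) (P i) y) (hd : Pairwise fun i j => (P i).Disjoint (P j)) :
    n ≤ minCut (fun a => (D.tail h a).1) (fun a => (h a).1) J r y.1 := by
  classical
  obtain ⟨X, hyX, hrX, hX⟩ := exists_inCut_eq_minCut (tl := fun a => (D.tail h a).1)
    (hd := fun a => (h a).1) J hy
  rw [← hX]
  have hex : ∀ i, ∃ a ∈ P i, a ∈ J ∧ (D.tail h a).1 ∉ X ∧ (h a).1 ∈ X := by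
    intro i
    obtain ⟨γ, hi⟩ := hP i
    obtain ⟨a, ha, h'⟩ := exists_mem_enter (Walk.map (f := Prod.fst) hi.walk) hrX hyX
    exact ⟨a, ha, (hJ a).2 (hi.mem_rootArcs ha), h'⟩
  choose f hf hf' using hex
  have hinj : Function.Injective f := by
    intro i j hij
    by_contra hne
    exact hd hne (hf i) (hij ▸ hf j)
  calc n = (Finset.univ.image f).card := by
        rw [Finset.card_image_of_injective _ hinj]; simp
    _ ≤ _ := Finset.card_le_card fun a ha => by
        obtain ⟨i, -, rfl⟩ := Finset.mem_image.1 ha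
        exact Finset.mem_filter.2 (hf' i)

end Directed

/-! ### Edge-disjoint paths through blossoms. -/

namespace IsBlossomStructure

variable {r : V} {b : V → V} {s : V → ℤˣ} {F : Set E}

/-- Every moved vertex is sent to the sign opposite to the base sign, so nothing but the base state
itself can contract to it. -/
theorem eq_of_contract_eq {x : V × ℤˣ} {u : V} (hx : contract b s x = (u, s u)) :
    x = (u, s u) := by
  by_cases hb : b x.1 = x.1
  · rwa [contract_of_eq hb] at hx
  · rw [contract_of_ne hb] at hx
    have h₁ : b x.1 = u := congrArg Prod.fst hx
    rw [h₁] at hx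
    exact absurd (congrArg Prod.snd hx) (Int.units_neg_ne _)

theorem exists_proj' (hb : IsBlossomStructure D h r b s F) {γ : ℤˣ} {p : List A} {y : V × ℤˣ}
    (hp : D.BiPath h (r, γ) p y) : ∃ q, q.Sublist p ∧
      D.BiPath (contract b s ∘ h) (r, γ) q (mate (contract b s (mate y))) := by
  obtain ⟨q, hqp, hq₁, hq₂, -⟩ := hb.exists_proj hp
  refine ⟨q, hqp, ?_⟩
  by_cases hnt : ∃ v, b v = b y.1 ∧ b v ≠ v
  · obtain ⟨hQ, hQ'⟩ := hq₁ hnt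
    by_cases hy : b y.1 = y.1
    · rw [mate_contract_of_eq hy, hQ' hy]; exact hQ
    · rw [mate_contract_of_ne hy]; exact hQ
  · push Not at hnt
    rw [mate_contract_of_eq (hnt _ rfl)]
    exact hq₂ hnt

/-- The last dart already arrives at the base before contraction, so nothing has to be inserted
inside the fibre of `u`. This keeps that fibre free for the loop in `not_disjoint_of_base`. -/
theorem exists_lift_base (hb : IsBlossomStructure D h r b s F) {γ : ℤˣ} {p : List A} {u : V}
    (hu : ∃ v, b v = u ∧ b v ≠ v) (hp : D.BiPath (contract b s ∘ h) (r, γ) p (u, s u)) :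
    ∃ q, D.BiPath h (r, γ) q (u, s u) ∧ ∀ d ∈ q, d ∈ p ∨ b (D.tail h d).1 = b (h d).1 ∧
      (∃ v, b v = b (h d).1 ∧ b v ≠ v) ∧ b (h d).1 ≠ u ∧
      b (h d).1 ∈ r :: verts (contract b s ∘ h) p := by
  have hbr : b r = r := (hb.root r).2 rfl
  obtain ⟨v, rfl, hv⟩ := hu
  induction p using List.reverseRecOn with
  | nil =>
    have h₁ : r = b v := congrArg Prod.fst (show (r, γ) = _ from hp.walk)
    exact absurd (h₁.symm.trans ((hb.root v).1 h₁.symm).symm) hv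
  | append_singleton p d _ =>
    obtain ⟨hw, hd⟩ := Walk.concat_iff.1 hp.walk
    have hd' := eq_of_contract_eq hd
    have hp' := hp.of_append_left hw
    have hn := hp.nodup
    rw [verts_append, ← List.cons_append, List.nodup_append'] at hn
    have hdn : b v ∉ r :: verts (contract b s ∘ h) p := by
      have := hn.2.2
      simp only [verts_cons, verts_nil, hd] at this
      simpa [List.disjoint_right] using this
    rw [tail_contract] at hp'
    have hx : contract b s (r, γ) = (r, γ) := contract_of_eq hbr
    rw [← hx] at hp'
    obtain ⟨q, hq, hq'⟩ := hb.exists_lift hp'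
    simp only [hbr] at hq'
    refine ⟨q ++ [d], ?_, ?_⟩
    · rw [← hd']
      refine hq.concat ?_
      rw [hd']
      intro hm
      rcases List.mem_cons.1 hm with h₁ | h₁
      · exact hdn (by simp [show b v = r from h₁])
      · obtain ⟨e, he, h₂⟩ := List.mem_map.1 h₁
        have h₃ := (hq' e he).1
        rw [h₂, hb.idem] at h₃
        exact hdn h₃
    · intro e he
      rcases List.mem_append.1 he with he | he
      · obtain ⟨h₁, h₂⟩ := hq' e he
        rcases h₂ with h₂ | ⟨-, h₂, h₃⟩
        · exact Or.inl (by simp [h₂])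
        · refine Or.inr ⟨h₂, h₃, fun h' => hdn (h' ▸ h₁), ?_⟩
          rw [verts_append, ← List.cons_append]
          exact List.mem_append_left _ h₁
      · exact Or.inl (by simp_all)

/-- The base of a nontrivial blossom is not the end of two edge-disjoint paths. -/
theorem not_disjoint_of_base (hb : IsBlossomStructure D h r b s F) (hT : NoRootTrail D h r)
    {u : V} (hu : ∃ v, b v = u ∧ b v ≠ v) {γ₁ γ₂ : ℤˣ} {p₁ p₂ : List A}
    (hp₁ : D.BiPath (contract b s ∘ h) (r, γ₁) p₁ (u, s u))
    (hp₂ : D.BiPath (contract b s ∘ h) (r, γ₂) p₂ (u, s u)) :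
    ¬ List.Disjoint (p₁.map D.edge) (p₂.map D.edge) := by
  induction hk : p₁.length using Nat.strong_induction_on generalizing u p₁ p₂ with
  | _ k ih =>
  intro hdis
  have hroot : ∀ v, b v ≠ v → b v ≠ r := fun v hv h' =>
    hv (h'.trans ((hb.root v).1 h').symm)
  have hext : ∀ {γ p y}, D.BiPath (contract b s ∘ h) (r, γ) p y → ∀ d ∈ p,
      b (D.tail h d).1 ≠ b (h d).1 := by
    intro γ p y hp d hd
    have := (hp.mem_rootArcs hd).2.1
    rw [tail_contract] at this
    simpa using this
  obtain ⟨q₁, hq₁, hq₁'⟩ := hb.exists_lift_base hu hp₁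
  obtain ⟨q₂, hq₂, hq₂'⟩ := hb.exists_lift_base hu hp₂
  have hrev : ∀ {d e}, D.edge d = D.edge e → b (D.tail h d).1 = b (h d).1 →
      b (D.tail h e).1 = b (h e).1 ∧ b (h d).1 = b (h e).1 := by
    intro d e hde hd
    rcases D.eq_or_eq_rev hde with rfl | rfl
    · exact ⟨hd, rfl⟩
    · rw [tail_rev, D.head_rev h] at hd
      rw [D.head_rev h]
      exact ⟨hd.symm, hd.symm⟩
  -- Lifts can share an edge only inside a nontrivial fibre that both paths visit. Then the initial
  -- segments up to its base are edge-disjoint paths to a base, the first of them shorter than `p₁`.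
  have hq : List.Disjoint (q₁.map D.edge) (q₂.map D.edge) := by
    intro e he₁ he₂
    obtain ⟨d₁, hd₁, rfl⟩ := List.mem_map.1 he₁
    obtain ⟨d₂, hd₂, hde⟩ := List.mem_map.1 he₂
    rcases hq₁' d₁ hd₁ with h₁ | ⟨h₁, h₁', h₁'', h₁'''⟩
    · rcases hq₂' d₂ hd₂ with h₂ | ⟨h₂, -⟩
      · exact hdis (List.mem_map_of_mem h₁) (hde ▸ List.mem_map_of_mem h₂)
      · exact hext hp₁ d₁ h₁ (hrev hde h₂).1
    · obtain ⟨h₃, h₄⟩ := hrev hde.symm h₁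
      rcases hq₂' d₂ hd₂ with h₂ | ⟨h₂, h₂', h₂'', h₂'''⟩
      · exact hext hp₂ d₂ h₂ h₃
      · rw [← h₄] at h₂'''
        obtain ⟨v, hv, hv'⟩ := h₁'
        have hvr : b (h d₁).1 ≠ r := hv ▸ hroot v hv'
        have hbase : D.Reach (contract b s ∘ h) r (b (h d₁).1, s (b (h d₁).1)) :=
          hv ▸ hb.base v hv'
        obtain ⟨a₁, c₁, ε₁, rfl, ha₁, hc₁⟩ := hp₁.walk.exists_split h₁'''
        obtain ⟨a₂, c₂, ε₂, rfl, ha₂, -⟩ := hp₂.walk.exists_split h₂'''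
        have hA₁ := hp₁.of_append_left ha₁
        have hA₂ := hp₂.of_append_left ha₂
        rw [eq_of_reach hb.unique ⟨_, _, hA₁⟩ hbase rfl hvr] at hA₁
        rw [eq_of_reach hb.unique ⟨_, _, hA₂⟩ hbase rfl hvr] at hA₂
        have hc₁ne : c₁ ≠ [] := by
          rintro rfl
          exact h₁'' (congrArg Prod.fst (show (b (h d₁).1, ε₁) = (u, s u) from hc₁))
        refine ih a₁.length ?_ ⟨v, hv, hv'⟩ hA₁ hA₂ rfl ?_
        · rw [← hk]
          have := List.length_pos_of_ne_nil hc₁ne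
          simp; omega
        · rw [List.map_append, List.map_append] at hdis
          exact fun e h h' => hdis (List.mem_append_left _ h) (List.mem_append_left _ h')
  obtain ⟨v, rfl, hv⟩ := hu
  obtain ⟨l, hl, hln, hl'⟩ := hb.loop v hv
  have hlt : ∀ d ∈ l, b (D.tail h d).1 = b v := by
    intro d hd
    rcases List.mem_cons.1 (BiWalk.tail_mem hl hd) with h₁ | h₁
    · rw [h₁]; exact hb.idem v
    · obtain ⟨e, he, h₂⟩ := List.mem_map.1 h₁
      rw [← h₂]; exact hl' e he
  have hlq : ∀ {γ : ℤˣ} {p q : List A}, D.BiPath (contract b s ∘ h) (r, γ) p (b v, s (b v)) →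
      (∀ d ∈ q, d ∈ p ∨ b (D.tail h d).1 = b (h d).1 ∧
      (∃ v, b v = b (h d).1 ∧ b v ≠ v) ∧ b (h d).1 ≠ b v ∧
      b (h d).1 ∈ r :: verts (contract b s ∘ h) p) →
      List.Disjoint (l.map D.edge) (q.map D.edge) := by
    intro γ p q hp hq' e he₁ he₂
    obtain ⟨d₁, hd₁, rfl⟩ := List.mem_map.1 he₁
    obtain ⟨d₂, hd₂, hde⟩ := List.mem_map.1 he₂
    obtain ⟨h₃, h₄⟩ := hrev hde.symm ((hlt d₁ hd₁).trans (hl' d₁ hd₁).symm)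
    rcases hq' d₂ hd₂ with h₂ | ⟨-, -, h₂, -⟩
    · exact hext hp d₂ h₂ h₃
    · exact h₂ (h₄ ▸ hl' d₁ hd₁)
  have hrv := hq₂.reverse
  rw [mate_mk] at hrv
  have hne : q₂ ≠ [] := by
    rintro rfl
    exact hroot v hv (congrArg Prod.fst (show (r, γ₂) = (b v, s (b v)) from hq₂.walk)).symm
  -- The loop reverses the sign at the base, so one lift, the loop and the other lift backwards form
  -- a closed trail at `r`.
  have hw := Walk.append (Walk.append hq₁.walk hl) hrv.walk
  refine hT _ _ _ (by simp [DartSystem.reverse, hne]) hw ?_ ?_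
  · rw [List.map_append, List.map_append, reverse_edges, List.nodup_append', List.nodup_append']
    refine ⟨⟨BiWalk.edges_nodup hq₁.walk hq₁.nodup.of_cons, BiWalk.edges_nodup hl hln,
      (hlq hp₁ hq₁').symm⟩,
      List.nodup_reverse.2 (BiWalk.edges_nodup hq₂.walk hq₂.nodup.of_cons), ?_⟩
    intro e he₁ he₂
    rw [List.mem_reverse] at he₂
    rcases List.mem_append.1 he₁ with h₁ | h₁
    · exact hq h₁ he₂
    · exact hlq hp₂ hq₂' h₁ he₂
  · have hrne : D.reverse q₂ ≠ [] := by simp [DartSystem.reverse, hne]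
    obtain ⟨m, e, hme⟩ : ∃ m e, D.reverse q₂ = m ++ [e] :=
      ⟨_, _, (List.dropLast_append_getLast hrne).symm⟩
    have hn := hrv.nodup.of_cons
    have hlast := (Walk.concat_iff.1 (hme ▸ hrv.walk)).2
    rw [hme, verts_append, List.nodup_append'] at hn
    rw [hme, ← List.append_assoc, verts_append, verts_cons, verts_nil, List.dropLast_concat,
      verts_append, verts_append]
    simp only [List.mem_append, not_or]
    refine ⟨⟨(List.nodup_cons.1 hq₁.nodup).1, ?_⟩, ?_⟩
    · intro hrl
      obtain ⟨d, hd, h₁⟩ := List.mem_map.1 hrl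
      have := hl' d hd
      rw [h₁, (hb.root r).2 rfl] at this
      exact hroot v hv this.symm
    · intro hrm
      refine hn.2.2 hrm ?_
      simp [hlast]

/-- A larger connectivity would give two arc-disjoint paths by Menger's theorem. They are
edge-disjoint, as only one orientation of each edge is a root arc. -/
theorem minCut_base_le (hb : IsBlossomStructure D h r b s F) (hT : NoRootTrail D h r)
    {J : Finset A} (hJ : ∀ a, a ∈ J ↔ a ∈ D.rootArcs (contract b s ∘ h) r) {v : V}
    (hv : b v ≠ v) :
    minCut (fun a => (D.tail (contract b s ∘ h) a).1) (fun a => ((contract b s ∘ h) a).1) J r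
      (b v) ≤ 1 := by
  by_contra hlt
  have hvr : b v ≠ r := fun h' => hv (h'.trans ((hb.root v).1 h').symm)
  obtain ⟨P, hP, hd⟩ := exists_disjoint_paths (k := 2)
    (fun X hX hr => (Nat.lt_of_not_le hlt).trans_le (minCut_le hX hr))
  have hpath : ∀ i, ∃ γ, D.BiPath (contract b s ∘ h) (r, γ) (P i) (b v, s (b v)) := by
    intro i
    obtain ⟨γ, ε, hi⟩ := biPath_of_walk hb.unique hvr (hP i).1 (hP i).2.1
      (fun a ha => (hJ a).1 ((hP i).2.2 a ha))
    have := eq_of_reach hb.unique ⟨_, _, hi⟩ (hb.base v hv) rfl hvr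
    rw [this] at hi
    exact ⟨γ, hi⟩
  obtain ⟨γ₁, h₁⟩ := hpath 0
  obtain ⟨γ₂, h₂⟩ := hpath 1
  refine hb.not_disjoint_of_base hT ⟨v, rfl, hv⟩ h₁ h₂ ?_
  intro e he₁ he₂
  obtain ⟨d₁, hd₁, rfl⟩ := List.mem_map.1 he₁
  obtain ⟨d₂, hd₂, hde⟩ := List.mem_map.1 he₂
  have := injOn_edge_rootArcs hb.unique (h₂.mem_rootArcs hd₂) (h₁.mem_rootArcs hd₁) hde
  subst this
  exact hd (show (0 : Fin 2) ≠ 1 by decide) hd₁ hd₂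

/-- Arc-disjoint paths of the contracted graph lift to edge-disjoint paths if at most one arc
enters each nontrivial blossom. -/
theorem hasDisjointPaths (hb : IsBlossomStructure D h r b s F) {J : Finset A}
    (hJ : ∀ a ∈ J, a ∈ D.rootArcs (contract b s ∘ h) r)
    (hJ' : ∀ v, b v ≠ v → inCut (fun a => (D.tail (contract b s ∘ h) a).1)
      (fun a => ((contract b s ∘ h) a).1) J {b v} ≤ 1) {y : V × ℤˣ} (hyr : y.1 ≠ r)
    (hy : D.Reach (contract b s ∘ h) r (mate (contract b s (mate y)))) {n : ℕ}
    (hn : n ≤ minCut (fun a => (D.tail (contract b s ∘ h) a).1)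
      (fun a => ((contract b s ∘ h) a).1) J r (b y.1)) :
    HasDisjointPaths D h r (D.edge '' J ∪ F) n y := by
  classical
  have hbr : b r = r := (hb.root r).2 rfl
  have hbyr : b y.1 ≠ r := fun h' => hyr ((hb.root _).1 h')
  obtain ⟨P, hP, hd⟩ := exists_disjoint_paths (k := n)
    (fun X hX hr => hn.trans (minCut_le hX hr))
  have hlift : ∀ i, ∃ q, (∃ γ, D.BiPath h (r, γ) q y) ∧ ∀ d ∈ q,
      b (h d).1 ∈ r :: verts (contract b s ∘ h) (P i) ∧ (d ∈ P i ∨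
      D.edge d ∈ F ∧ b (D.tail h d).1 = b (h d).1 ∧ ∃ v, b v = b (h d).1 ∧ b v ≠ v) := by
    intro i
    obtain ⟨γ, ε, hi⟩ := biPath_of_walk hb.unique hbyr (hP i).1 (hP i).2.1
      (fun a ha => hJ a ((hP i).2.2 a ha))
    rw [eq_of_reach hb.unique ⟨_, _, hi⟩ hy (by simp) (by simpa using hbyr)] at hi
    have hx : contract b s (r, γ) = (r, γ) := contract_of_eq hbr
    rw [← hx] at hi
    obtain ⟨q, hq, hq'⟩ := hb.exists_lift hi
    simp only [hbr] at hq'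
    exact ⟨q, ⟨γ, hq⟩, hq'⟩
  choose Q hQ hQ' using hlift
  have hext : ∀ i, ∀ d ∈ P i, b (D.tail h d).1 ≠ b (h d).1 := by
    intro i d hd
    have := (hJ d ((hP i).2.2 d hd)).2.1
    rw [tail_contract] at this
    simpa using this
  have hrev : ∀ {d e}, D.edge d = D.edge e → b (D.tail h d).1 = b (h d).1 →
      b (D.tail h e).1 = b (h e).1 ∧ b (h d).1 = b (h e).1 := by
    intro d e hde hd
    rcases D.eq_or_eq_rev hde with rfl | rfl
    · exact ⟨hd, rfl⟩
    · rw [tail_rev, D.head_rev h] at hd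
      rw [D.head_rev h]
      exact ⟨hd.symm, hd.symm⟩
  refine ⟨Q, fun i => ⟨hQ i, fun d hd => ?_⟩, ?_⟩
  · rcases (hQ' i d hd).2 with h₁ | h₁
    · exact Or.inl ⟨d, (hP i).2.2 d h₁, rfl⟩
    · exact Or.inr h₁.1
  · intro i j hij e he₁ he₂
    obtain ⟨d₁, hd₁, rfl⟩ := List.mem_map.1 he₁
    obtain ⟨d₂, hd₂, hde⟩ := List.mem_map.1 he₂
    obtain ⟨h₁, h₁'⟩ := hQ' i d₁ hd₁
    obtain ⟨h₂, h₂'⟩ := hQ' j d₂ hd₂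
    rcases h₁' with h₁' | ⟨-, h₁', v, hv, hv'⟩
    · rcases h₂' with h₂' | ⟨-, h₂', -⟩
      · have := injOn_edge_rootArcs hb.unique (hJ _ ((hP j).2.2 _ h₂'))
          (hJ _ ((hP i).2.2 _ h₁')) hde
        subst this
        exact hd hij h₁' h₂'
      · exact hext i d₁ h₁' (hrev hde h₂').1
    · obtain ⟨h₃, h₄⟩ := hrev hde.symm h₁'
      rcases h₂' with h₂' | -
      · exact hext j d₂ h₂' h₃
      -- A shared edge inside a blossom means that both contracted paths visit its base, hence use
      -- the only arc of `J` that enters it.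
      · rw [← h₄] at h₂
        rw [← hv] at h₁ h₂
        have hvr : b v ≠ r := fun h' => hv' (h'.trans ((hb.root v).1 h').symm)
        obtain ⟨a₁, ha₁, ha₁'⟩ := List.mem_map.1 ((List.mem_cons.1 h₁).resolve_left hvr)
        obtain ⟨a₂, ha₂, ha₂'⟩ := List.mem_map.1 ((List.mem_cons.1 h₂).resolve_left hvr)
        have hmem : ∀ a ∈ J, ((contract b s ∘ h) a).1 = b v →
            (D.tail (contract b s ∘ h) a).1 ∉ ({b v} : Set V) ∧
              ((contract b s ∘ h) a).1 ∈ ({b v} : Set V) :=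
          fun a haJ h' => ⟨fun h'' => (hJ a haJ).2.1 (by rw [h', h'']), h'⟩
        have hJ₁ := (hP i).2.2 a₁ ha₁
        have hJ₂ := (hP j).2.2 a₂ ha₂
        have heq := eq_of_inCut_le_one (hJ' v hv') hJ₁ hJ₂ (hmem a₁ hJ₁ ha₁') (hmem a₂ hJ₂ ha₂')
        subst heq
        exact hd hij ha₁ ha₂

end IsBlossomStructure

/-- If there is no closed trail at the root, then there is a set `F` of edges that preserves the
numbers of edge-disjoint paths from the root and has at most as many elements as there are such
paths in total. -/
theorem exists_flame [Fintype V] [DecidableEq V] [Finite A] {r : V} (hT : NoRootTrail D h r) :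
    ∃ F : Set E, (∀ y : V × ℤˣ, y.1 ≠ r → ∀ n, HasDisjointPaths D h r Set.univ n y →
      HasDisjointPaths D h r F n y) ∧
      ∃ c : V × ℤˣ → ℕ, (∀ y, y.1 ≠ r → HasDisjointPaths D h r F (c y) y) ∧
        F.ncard ≤ ∑ v ∈ Finset.univ.erase r, ∑ α, c (v, α) := by
  classical
  obtain ⟨b, s, F, hb⟩ := exists_isBlossomStructure (D := D) (r := r) h (by
    intro γ γ' p hne hn hp
    refine hT γ γ' p hne hp (BiWalk.edges_nodup hp hn) ?_
    have hne' : verts h p ≠ [] := by simpa [verts] using hne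
    have hlast : (verts h p).getLast hne' = r := by
      obtain ⟨m, e, rfl⟩ : ∃ m e, p = m ++ [e] :=
        ⟨_, _, (List.dropLast_append_getLast hne).symm⟩
      have := (Walk.concat_iff.1 hp).2
      simp [verts, this]
    rw [← List.dropLast_append_getLast hne', hlast, List.nodup_append'] at hn
    exact fun h' => hn.2.2 h' (by simp))
  set K := contract b s ∘ h with hK
  set tl : A → V := fun a => (D.tail K a).1 with htl
  set hd : A → V := fun a => (K a).1 with hhd
  have hfin : (D.rootArcs K r).Finite := Set.toFinite _
  have hJ₀ : ∀ a, a ∈ hfin.toFinset ↔ a ∈ D.rootArcs K r := fun a => hfin.mem_toFinset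
  obtain ⟨J, hJ, hfl⟩ := Digraph.exists_flame tl hd hfin.toFinset r
  have hJr : ∀ a ∈ J, a ∈ D.rootArcs K r := fun a ha => (hJ₀ a).1 (hJ ha)
  have hroot : ∀ v, b v ≠ v → b v ≠ r := fun v hv h' =>
    hv (h'.trans ((hb.root v).1 h').symm)
  have hJ' : ∀ v, b v ≠ v → inCut tl hd J {b v} ≤ 1 := fun v hv => by
    rw [(hfl _ (hroot v hv)).2]
    exact hb.minCut_base_le hT hJ₀ hv
  have hlb : ∀ y : V × ℤˣ, y.1 ≠ r → ∀ n, D.Reach K r (mate (contract b s (mate y))) →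
      n ≤ minCut tl hd J r (b y.1) → HasDisjointPaths D h r (D.edge '' J ∪ F) n y :=
    fun y hyr n hy hn => hb.hasDisjointPaths hJr hJ' hyr hy hn
  have hzero : ∀ y, HasDisjointPaths D h r (D.edge '' J ∪ F) 0 y := fun y =>
    ⟨fun i => i.elim0, fun i => i.elim0, fun i => i.elim0⟩
  -- A state whose contraction is unreachable is the end of no path from `r`, so it is counted with
  -- zero.
  refine ⟨D.edge '' J ∪ F, ?_,
    fun y => if D.Reach K r (mate (contract b s (mate y))) then minCut tl hd J r (b y.1) else 0,
    ?_, ?_⟩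
  · rintro y hyr n ⟨Q, hQ, hdis⟩
    rcases n with _ | n
    · exact hzero y
    have hproj : ∀ i, ∃ q, q.Sublist (Q i) ∧
        ∃ γ, D.BiPath K (r, γ) q (mate (contract b s (mate y))) := by
      intro i
      obtain ⟨γ, hi⟩ := (hQ i).1
      obtain ⟨q, h₁, h₂⟩ := hb.exists_proj' hi
      exact ⟨q, h₁, γ, h₂⟩
    choose P hP₁ hP₂ using hproj
    have hbyr : b y.1 ≠ r := fun h' => hyr ((hb.root _).1 h')
    have hle := le_minCut hJ₀ (y := mate (contract b s (mate y))) (by simpa using hbyr) hP₂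
      (fun i j hij a ha ha' => hdis hij (List.mem_map_of_mem ((hP₁ i).subset ha))
        (List.mem_map_of_mem ((hP₁ j).subset ha')))
    refine hlb y hyr _ ⟨_, _, (hP₂ 0).choose_spec⟩ ?_
    rw [(hfl _ hbyr).1]
    simpa using hle
  · intro y hyr
    beta_reduce
    split_ifs with hy
    · exact hlb y hyr _ hy le_rfl
    · exact hzero y
  · have h₁ : (D.edge '' (J : Set A)).ncard ≤ ∑ v ∈ Finset.univ.erase r, inCut tl hd J {v} := by
      refine (Set.ncard_image_le J.finite_toSet).trans ?_
      rw [Set.ncard_coe_finset, Finset.card_eq_sum_card_fiberwise (f := hd)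
        (t := Finset.univ.erase r) (fun a ha => by simpa using (hJr a ha).2.2)]
      exact Finset.sum_le_sum fun v _ => card_filter_head_le_inCut (fun a ha => (hJr a ha).2.1) v
    have h₂ : F.ncard ≤ ∑ v ∈ Finset.univ.erase r, if b v ≠ v then 2 else 0 := by
      refine hb.ncard_le.trans ?_
      rw [← Finset.sum_filter, Finset.sum_const, smul_eq_mul, mul_comm, Set.ncard_eq_toFinset_card']
      refine Nat.mul_le_mul_right _ (Finset.card_le_card fun v hv => ?_)
      have hv' : b v ≠ v := by simpa using hv
      simp only [Finset.mem_filter, Finset.mem_erase, Finset.mem_univ, and_true]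
      exact ⟨fun h' => hv' (by rw [h']; exact (hb.root r).2 rfl), hv'⟩
    refine (Set.ncard_union_le _ _).trans ((add_le_add h₁ h₂).trans ?_)
    rw [← Finset.sum_add_distrib]
    refine Finset.sum_le_sum fun v hv => ?_
    have hvr := Finset.ne_of_mem_erase hv
    by_cases hbv : b v = v
    · rw [if_neg (by simpa using hbv), add_zero, (hfl v hvr).2, ← (hfl v hvr).1]
      rcases Nat.eq_zero_or_pos (minCut tl hd J r v) with h₀ | h₀
      · rw [h₀]; exact Nat.zero_le _
      · obtain ⟨P, hP, -⟩ := exists_disjoint_paths (k := 1)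
          (fun X hX hr => (show 1 ≤ _ from h₀).trans (minCut_le hX hr))
        obtain ⟨γ, ε, hi⟩ := biPath_of_walk hb.unique hvr (hP 0).1 (hP 0).2.1
          (fun a ha => hJr a ((hP 0).2.2 a ha))
        -- Only the reachable sign `ε` of a fixed vertex is needed to pay for the arcs of `J`
        -- entering it.
        refine le_trans ?_ (Finset.single_le_sum (fun _ _ => Nat.zero_le _) (Finset.mem_univ ε))
        beta_reduce
        rw [mate_contract_of_eq (by exact hbv), if_pos ⟨_, _, hi⟩, hbv]
    · have h₀ : inCut tl hd J {v} = 0 := by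
        refine inCut_eq_zero fun a _ h' => hbv ?_
        have h₃ : b (h a).1 = v := by simpa [hhd, hK] using h'
        rw [← h₃, hb.idem]
      have h₁ : 1 ≤ minCut tl hd J r (b v) := by
        rw [(hfl _ (hroot v hbv)).1]
        obtain ⟨γ, p, hp⟩ := hb.base v hbv
        exact le_minCut hJ₀ (n := 1) (y := (b v, s (b v))) (P := fun _ => p) (hroot v hbv)
          (fun _ => ⟨γ, hp⟩) (fun i j hij => absurd (Subsingleton.elim i j) hij)
      -- No arc of `J` ends in an absorbed vertex, and both of its signs have a path through the
      -- base; this pays for two edges of `F`.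
      have h₄ : ∀ α : ℤˣ, 1 ≤ if D.Reach K r (mate (contract b s (mate (v, α)))) then
          minCut tl hd J r (b (v, α).1) else 0 := by
        intro α
        rw [mate_contract_of_ne (by exact hbv), if_pos (hb.base v hbv)]
        exact h₁
      rw [h₀, if_pos hbv]
      calc 0 + 2 = ∑ α : ℤˣ, 1 := by simp
        _ ≤ _ := Finset.sum_le_sum fun α _ => h₄ α

end DartSystem

/-! ### Translation to bidirected graphs and the main theorem. -/

theorem Walk.map_arcs {A A' S : Type*} {t h : A → S} {f : A' → A} {x y : S} {p : List A'} :
    Walk t h x (p.map f) y ↔ Walk (t ∘ f) (h ∘ f) x p y := by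
  induction p generalizing x with
  | nil => rfl
  | cons d p ih => simp [ih]

namespace BidirectedGraph

open DartSystem

variable {V E : Type*} (B : BidirectedGraph V E)

/-- The oriented edges of a bidirected graph as a system of darts. -/
def darts : DartSystem B.OrientedEdge E where
  rev d := ⟨d.edge, d.head, d.tail, by rw [d.ends_eq, Sym2.eq_swap]⟩
  edge := OrientedEdge.edge
  rev_rev _ := rfl
  edge_rev _ := rfl
  eq_or_eq_rev := by
    intro d e hde
    have h := d.ends_eq
    rw [hde, e.ends_eq, Sym2.eq_iff] at h
    rcases h with ⟨h₁, h₂⟩ | ⟨h₁, h₂⟩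
    · exact Or.inl (OrientedEdge.ext hde h₁.symm h₂.symm)
    · exact Or.inr (OrientedEdge.ext hde h₂.symm h₁.symm)

/-- The signed vertex at which an oriented edge arrives. -/
def headState (d : B.OrientedEdge) : V × ℤˣ := (d.head, d.headSign)

variable {B}

theorem joins_of_biWalk {x y : V × ℤˣ} {p : List B.OrientedEdge}
    (hp : B.darts.BiWalk B.headState x p y) : B.Joins x.1 p y.1 ∧
      p.IsChain (fun d d' => d'.tailSign = -d.headSign) ∧ ∀ d ∈ p.getLast?, d.headSign = y.2 := by
  induction p generalizing x with
  | nil =>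
    obtain rfl : x = y := hp
    exact ⟨rfl, by simp, by simp⟩
  | cons d p ih =>
    obtain ⟨h₁, h₂, h₃⟩ := ih hp.2
    have hd : (d.tail, -d.tailSign) = x := hp.1
    refine ⟨⟨congrArg Prod.fst hd, h₁⟩, ?_, ?_⟩
    · rcases p with _ | ⟨e, p⟩
      · simp
      · refine List.isChain_cons_cons.2 ⟨?_, h₂⟩
        have he : (e.tail, -e.tailSign) = (d.head, d.headSign) := hp.2.1
        have hs : -e.tailSign = d.headSign := congrArg Prod.snd he
        rw [← hs, neg_neg]
    · rcases p with _ | ⟨e, p⟩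
      · have he : (d.head, d.headSign) = y := hp.2
        simp [← he]
      · simpa using h₃

theorem biWalk_of_joins {x y : V} {p : List B.OrientedEdge} (hp : B.Joins x p y)
    (hs : p.IsChain (fun d d' => d'.tailSign = -d.headSign)) {d : B.OrientedEdge}
    (hd : p.getLast? = some d) :
    ∃ γ, B.darts.BiWalk B.headState (x, γ) p (y, d.headSign) := by
  induction p generalizing x with
  | nil => simp at hd
  | cons e p ih =>
    obtain ⟨rfl, hp⟩ := hp
    refine ⟨-e.tailSign, rfl, ?_⟩
    rcases p with _ | ⟨f, p⟩
    · obtain rfl : e = d := by simpa using hd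
      have hy : e.head = y := hp
      subst hy
      rfl
    · obtain ⟨h₁, h₂⟩ := List.isChain_cons_cons.1 hs
      obtain ⟨γ, hγ⟩ := ih hp h₂ (by simpa using hd)
      have hf : (f.tail, -f.tailSign) = (e.head, γ) := hγ.1
      have hs : -f.tailSign = γ := congrArg Prod.snd hf
      have : γ = e.headSign := by rw [← hs, h₁, neg_neg]
      rwa [this] at hγ

/-- Since `y ≠ x`, a path has a last edge, which fixes the arrival sign. The initial sign is free
because no edge precedes the first. -/
theorem isSignedPath_iff {x y : V} (hxy : y ≠ x) {α : ℤˣ} {p : List B.OrientedEdge} :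
    B.IsSignedPath x p y α ↔ ∃ γ, B.darts.BiPath B.headState (x, γ) p (y, α) := by
  constructor
  · rintro ⟨hp, d, hd, rfl⟩
    obtain ⟨γ, hγ⟩ := biWalk_of_joins hp.joins hp.signs hd
    exact ⟨γ, hγ, hp.vertices_nodup⟩
  · rintro ⟨γ, hp⟩
    have hne : p ≠ [] := by
      rintro rfl
      exact hxy (congrArg Prod.fst (show (x, γ) = (y, α) from hp.walk)).symm
    obtain ⟨h₁, h₂, h₃⟩ := joins_of_biWalk hp.walk
    exact ⟨⟨⟨h₁, BiWalk.edges_nodup hp.walk hp.nodup.of_cons, h₂⟩, hp.nodup⟩, p.getLast hne,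
      List.getLast?_eq_some_getLast hne, h₃ _ (List.getLast?_eq_some_getLast hne)⟩

/-- The last edge of a closed trail at `r` would be terminal in both orientations: into `r` by the
trail, and out of `r` as a trail of length one. -/
theorem noRootTrail_of_edgeClean {r : V} (hB : B.EdgeClean r) :
    B.darts.NoRootTrail B.headState r := by
  intro γ γ' p hne hp hn hr
  obtain ⟨h₁, h₂, -⟩ := joins_of_biWalk hp
  obtain ⟨m, d, rfl⟩ : ∃ m d, p = m ++ [d] := ⟨_, _, (List.dropLast_append_getLast hne).symm⟩
  have hd : d.head = r := congrArg Prod.fst (Walk.concat_iff.1 hp).2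
  obtain ⟨d₀, -, hu⟩ := hB d.edge (by rw [d.ends_eq, hd]; simp)
  have h₃ := hu d ⟨rfl, m ++ [d], ⟨by rw [hd]; exact h₁, hn, h₂⟩, by simp, hr⟩
  have h₄ := hu (B.darts.rev d) ⟨rfl, [B.darts.rev d],
    ⟨⟨hd, rfl⟩, by simp, by simp⟩, by simp, by simp⟩
  have h₅ : d.head = d.tail := congrArg OrientedEdge.head (h₃.trans h₄.symm)
  refine B.loopless d.edge ?_
  rw [d.ends_eq, h₅]
  exact Sym2.mk_isDiag_iff.2 rfl

theorem le_pathConnectivity_iff [Finite E] {r v : V} (hv : v ≠ r) {α : ℤˣ} {n : ℕ} :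
    n ≤ B.pathConnectivity r v α ↔
      B.darts.HasDisjointPaths B.headState r Set.univ n (v, α) := by
  classical
  constructor
  · intro hn
    obtain ⟨P, ⟨hP, hd⟩, hc⟩ := (B.isGreatest_pathConnectivity r v α).1
    rw [← hc] at hn
    refine ⟨fun i => (P.equivFin.symm (Fin.castLE hn i)).1, fun i => ⟨?_, by simp⟩, ?_⟩
    · exact (isSignedPath_iff hv).1 (hP _ (P.equivFin.symm (Fin.castLE hn i)).2)
    · intro i j hij
      refine hd (P.equivFin.symm _).2 (P.equivFin.symm _).2 fun h => hij ?_
      exact Fin.castLE_injective hn (P.equivFin.symm.injective (Subtype.ext h))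
  · rintro ⟨Q, hQ, hd⟩
    -- Signed paths are nonempty, so equal paths would share an edge.
    have hinj : Function.Injective Q := by
      intro i j hij
      by_contra hne
      obtain ⟨-, d, hd', -⟩ := (isSignedPath_iff hv).2 (hQ i).1
      have hm := List.mem_map_of_mem (f := B.darts.edge) (List.mem_of_getLast? hd')
      exact hd hne hm (hij ▸ hm)
    refine (B.isGreatest_pathConnectivity r v α).2 ⟨Finset.univ.image Q, ⟨?_, ?_⟩, ?_⟩
    · intro p hp
      obtain ⟨i, -, rfl⟩ := Finset.mem_image.1 hp
      exact (isSignedPath_iff hv).2 (hQ i).1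
    · intro p hp q hq hpq
      obtain ⟨i, -, rfl⟩ := Finset.mem_image.1 hp
      obtain ⟨j, -, rfl⟩ := Finset.mem_image.1 hq
      exact hd fun h => hpq (by rw [h])
    · rw [Finset.card_image_of_injective _ hinj, Finset.card_univ, Fintype.card_fin]

/-- An oriented edge of a spanning subgraph as an oriented edge of the whole graph. -/
def OrientedEdge.ofSubgraph {F : Set E} (d : (B.spanningSubgraph F).OrientedEdge) :
    B.OrientedEdge := ⟨d.edge, d.tail, d.head, d.ends_eq⟩

theorem biPath_map_ofSubgraph {F : Set E} {x y : V × ℤˣ}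
    {p : List (B.spanningSubgraph F).OrientedEdge} :
    B.darts.BiPath B.headState x (p.map OrientedEdge.ofSubgraph) y ↔
      (B.spanningSubgraph F).darts.BiPath (B.spanningSubgraph F).headState x p y := by
  have hv : verts B.headState (p.map OrientedEdge.ofSubgraph) =
      verts (B.spanningSubgraph F).headState p := by
    simp only [verts, List.map_map]
    rfl
  constructor
  · exact fun hp => ⟨Walk.map_arcs.1 hp.walk, hv ▸ hp.nodup⟩
  · exact fun hp => ⟨Walk.map_arcs.2 hp.walk, hv ▸ hp.nodup⟩

theorem hasDisjointPaths_spanningSubgraph {F : Set E} {r : V} {n : ℕ} {y : V × ℤˣ} :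
    (B.spanningSubgraph F).darts.HasDisjointPaths (B.spanningSubgraph F).headState r Set.univ n y ↔
      B.darts.HasDisjointPaths B.headState r F n y := by
  have hedge : ∀ p : List (B.spanningSubgraph F).OrientedEdge,
      (p.map OrientedEdge.ofSubgraph).map B.darts.edge =
        (p.map (B.spanningSubgraph F).darts.edge).map Subtype.val := by
    intro p
    simp only [List.map_map]
    rfl
  constructor
  · rintro ⟨Q, hQ, hd⟩
    refine ⟨fun i => (Q i).map OrientedEdge.ofSubgraph, fun i => ⟨?_, ?_⟩, ?_⟩
    · obtain ⟨γ, hγ⟩ := (hQ i).1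
      exact ⟨γ, biPath_map_ofSubgraph.2 hγ⟩
    · intro d hd
      obtain ⟨e, -, rfl⟩ := List.mem_map.1 hd
      exact e.edge.2
    · intro i j hij
      rw [hedge, hedge]
      exact (hd hij).map Subtype.val_injective
  · rintro ⟨Q, hQ, hd⟩
    have hex : ∀ i, ∃ p : List (B.spanningSubgraph F).OrientedEdge,
        p.map OrientedEdge.ofSubgraph = Q i := by
      intro i
      have : Q i ∈ Set.range (List.map (OrientedEdge.ofSubgraph (B := B) (F := F))) := by
        rw [Set.range_list_map]
        exact fun d hd => ⟨⟨⟨d.edge, (hQ i).2 d hd⟩, d.tail, d.head, d.ends_eq⟩, rfl⟩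
      exact this
    choose P hP using hex
    refine ⟨P, fun i => ⟨?_, by simp⟩, ?_⟩
    · obtain ⟨γ, hγ⟩ := (hQ i).1
      rw [← hP] at hγ
      exact ⟨γ, biPath_map_ofSubgraph.1 hγ⟩
    · intro i j hij e he he'
      have := hd hij
      beta_reduce at this
      rw [← hP, ← hP, hedge, hedge] at this
      exact this (List.mem_map_of_mem he) (List.mem_map_of_mem he')

instance [Finite V] [Finite E] : Finite B.OrientedEdge :=
  Finite.of_injective (fun d => (d.edge, d.tail, d.head)) fun d e h => by
    simp only [Prod.mk.injEq] at h
    exact OrientedEdge.ext h.1 h.2.1 h.2.2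

end BidirectedGraph

open BidirectedGraph in
theorem mainTheorem4 {V E : Type*} [Fintype V] [DecidableEq V] [Finite E]
    (B : BidirectedGraph V E) (r : V) (hB : B.EdgeClean r) :
    ∃ F : Set E,
      (B.spanningSubgraph F).IsFlame r ∧
      ∀ v : V, v ≠ r → ∀ α : ℤˣ,
        (B.spanningSubgraph F).pathConnectivity r v α = B.pathConnectivity r v α := by
  obtain ⟨F, hF, c, hc, hcard⟩ := DartSystem.exists_flame (noRootTrail_of_edgeClean hB)
  refine ⟨F, ?_, fun v hv α => le_antisymm ?_ ?_⟩
  · unfold IsFlame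
    rw [Nat.card_coe_set_eq]
    refine hcard.trans (Finset.sum_le_sum fun v hv => Finset.sum_le_sum fun α _ => ?_)
    have hvr := Finset.ne_of_mem_erase hv
    exact (le_pathConnectivity_iff hvr).2 (hasDisjointPaths_spanningSubgraph.2 (hc (v, α) hvr))
  · obtain ⟨Q, hQ, hd⟩ :=
      hasDisjointPaths_spanningSubgraph.1
        ((le_pathConnectivity_iff (B := B.spanningSubgraph F) (α := α) hv).1 le_rfl)
    exact (le_pathConnectivity_iff hv).2 ⟨Q, fun i => ⟨(hQ i).1, by simp⟩, hd⟩
  · exact (le_pathConnectivity_iff hv).2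
      (hasDisjointPaths_spanningSubgraph.2 (hF (v, α) hv _ ((le_pathConnectivity_iff hv).1 le_rfl)))
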